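/- Let $d\ge 1$, let $X$ be a complex Banach space and let $p_0\in(1,2]$, $1/p_0+1/p_0'=1$. Assume that $X$ has Fourier type $p_0$ (on $\mathbb{R}^d$), i.e. there is a constant $K$ with $\|\widehat g\|_{L^{p_0'}(\mathbb{R}^d;X)}\le K\|g\|_{L^{p_0}(\mathbb{R}^d;X)}$ for all $X$-valued Schwartz functions $g$, where $\widehat g(\xi)=\int_{\mathbb{R}^d}g(t)e^{-2\pi i t\cdot\xi}\,dt$. Let $1\le q\le\infty$ and $b<-1/q$ (with $1/\infty=0$). Then the periodic Fourier transform $f\mapsto(\widehat f(n))_{n\in\mathbb{Z}^d}$, $\widehat f(n)=\int_{\mathbb{T}^d}f(x)e^{-2\pi i x\cdot n}\,dx$, is bounded $$L^{p_0,q}(\log L)^{b+1/\min\{p_0,q\}}(\mathbb{T}^d;X)\to\ell^{p_0',q}(\log\ell)^{b+1/\max\{p_0',q\}}(\mathbb{Z}^d;X).$$ That is, there is a constant $C<\infty$ such that every $f$ in the first space is Bochner integrable, its sequence of Fourier coefficients lies in the second space, and $$\|(\widehat f(n))_{n}\|_{\ell^{p_0',q}(\log\ell)^{b+1/\max\{p_0',q\}}(\mathbb{Z}^d;X)}\le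 C\,\|f\|_{L^{p_0,q}(\log L)^{b+1/\min\{p_0,q\}}(\mathbb{T}^d;X)}.$$ Here $\mathbb{T}^d$ carries the Lebesgue measure $|\cdot|$ of total mass $1$; for $c\in\mathbb{R}$, $L^{p,q}(\log L)^c(\mathbb{T}^d;X)$ consists of the strongly measurable $f:\mathbb{T}^d\to X$ with $$\|f\|_{L^{p,q}(\log L)^c}=\Big(\int_0^1\big(t^{1/p}(1+|\log t|)^c f^*(t)\big)^q\,\frac{dt}{t}\Big)^{1/q}<\infty,\qquad f^*(t)=\inf\{\lambda\ge0:|\{\|f\|_X>\lambda\}|\le t\},$$ and $\ell^{p,q}(\log\ell)^c(\mathbb{Z}^d;X)$ consists of the families $(x_n)_{n\in\mathbb{Z}^d}$ in $X$ with $$\|(x_n)\|_{\ell^{p,q}(\log\ell)^c}=\Big(\sum_{k=1}^\infty\big(k^{1/p}(1+\log k)^c x_k^*\big)^q\,\frac1k\Big)^{1/q}<\infty,$$ where $(x_k^*)_{k\ge1}$ is the non-increasing rearrangement of $(\|x_n\|_X)_{n\in\mathbb{Z}^d}$; if $q=\infty$, the integral and the sum are replaced by the suprema over $0<t<1$ and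 $k\ge1$ of the expressions in the inner brackets. -/

import Mathlib

open MeasureTheory
open scoped ENNReal NNReal FourierTransform SchwartzMap

noncomputable section

/-- `X` has Fourier type `p` on `ℝ^d`: there is a finite constant `C` with
`‖𝓕 f‖_{L^{p'}(ℝ^d; X)} ≤ C ‖f‖_{L^p(ℝ^d; X)}` for all `X`-valued Schwartz functions `f`, where
`p'` is the conjugate exponent and `𝓕 f ξ = ∫ e^{-2πi⟨t, ξ⟩} f t dt`. -/
def HasFourierType (d : ℕ) (p : ℝ≥0∞) (X : Type*) [NormedAddCommGroup X] [NormedSpace ℂ X] :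
    Prop :=
  ∃ C : ℝ≥0, ∀ f : 𝓢(EuclideanSpace ℝ (Fin d), X),
    eLpNorm (𝓕 (f : EuclideanSpace ℝ (Fin d) → X)) p.conjExponent volume ≤
      C * eLpNorm (f : EuclideanSpace ℝ (Fin d) → X) p volume

/-- The normalised Haar (Lebesgue) measure on `𝕋^d = (ℝ/ℤ)^d`; it is the measure that is used in
the definition of `UnitAddTorus.mFourierCoeff`. -/
def torusMeasure (d : ℕ) : Measure (UnitAddTorus (Fin d)) :=
  Measure.pi fun _ => AddCircle.haarAddCircle

/-- The non-increasing rearrangement of the function `s ↦ ‖f s‖`: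
`f^*(t) = inf {l ≥ 0 : μ {s : ‖f s‖ > l} ≤ t}`. -/
def rearrangement {S X : Type*} [MeasurableSpace S] [NormedAddCommGroup X]
    (μ : Measure S) (f : S → X) (t : ℝ≥0∞) : ℝ≥0∞ :=
  sInf {l : ℝ≥0∞ | μ {s | l < ‖f s‖ₑ} ≤ t}

/-- The weight `t^{1/p} (1 + |log t|)^b` for `t > 0` (with `1/∞ = 0`). -/
def lzWeight (p : ℝ≥0∞) (b t : ℝ) : ℝ≥0∞ :=
  ENNReal.ofReal (t ^ (1 / p).toReal * (1 + |Real.log t|) ^ b)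

open scoped Classical in
/-- The (quasi-)norm of the Lorentz–Zygmund space `L^{p,q}(log L)^b(S; X)`:
`(∫_0^{μ(S)} (t^{1/p} (1 + |log t|)^b f^*(t))^q dt/t)^{1/q}`, and
`sup_{0 < t < μ(S)} t^{1/p} (1 + |log t|)^b f^*(t)` if `q = ∞`. -/
def lzNorm {S X : Type*} [MeasurableSpace S] [NormedAddCommGroup X]
    (p q : ℝ≥0∞) (b : ℝ) (μ : Measure S) (f : S → X) : ℝ≥0∞ :=
  if q = ∞ then
    ⨆ t ∈ {t : ℝ | 0 < t ∧ ENNReal.ofReal t < μ Set.univ},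
      lzWeight p b t * rearrangement μ f (ENNReal.ofReal t)
  else
    (∫⁻ t in {t : ℝ | 0 < t ∧ ENNReal.ofReal t < μ Set.univ},
      (lzWeight p b t * rearrangement μ f (ENNReal.ofReal t)) ^ q.toReal
        * ENNReal.ofReal (1 / t)) ^ (1 / q.toReal)

/-- Membership in the Lorentz–Zygmund space `L^{p,q}(log L)^b(S; X)`. -/
def MemLZ {S X : Type*} [MeasurableSpace S] [NormedAddCommGroup X]
    (p q : ℝ≥0∞) (b : ℝ) (μ : Measure S) (f : S → X) : Prop :=
  AEStronglyMeasurable f μ ∧ lzNorm p q b μ f < ∞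

/-- The non-increasing rearrangement of a family `x` over a countable index set, indexed from `0`:
`seqRearrangement x k` is `x^*_{k+1} = inf {l ≥ 0 : #{n : ‖x n‖ > l} < k + 1}`. -/
def seqRearrangement {I X : Type*} [NormedAddCommGroup X] (x : I → X) (k : ℕ) : ℝ≥0∞ :=
  sInf {l : ℝ≥0∞ | Set.encard {n | l < ‖x n‖ₑ} < k + 1}

open scoped Classical in
/-- The (quasi-)norm of the sequence space `ℓ^{p,q}(log ℓ)^b(I; X)`:
`(∑_{k ≥ 1} (k^{1/p} (1 + log k)^b x^*_k)^q / k)^{1/q}`, and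
`sup_{k ≥ 1} k^{1/p} (1 + log k)^b x^*_k` if `q = ∞`. The sum is indexed by `k - 1`. -/
def lzSeqNorm {I X : Type*} [NormedAddCommGroup X]
    (p q : ℝ≥0∞) (b : ℝ) (x : I → X) : ℝ≥0∞ :=
  if q = ∞ then
    ⨆ k : ℕ, lzWeight p b ((k : ℝ) + 1) * seqRearrangement x k
  else
    (∑' k : ℕ, (lzWeight p b ((k : ℝ) + 1) * seqRearrangement x k) ^ q.toReal
      * ENNReal.ofReal (1 / ((k : ℝ) + 1))) ^ (1 / q.toReal)

/-- Membership in the sequence space `ℓ^{p,q}(log ℓ)^b(I; X)`. -/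
def MemLZSeq {I X : Type*} [NormedAddCommGroup X]
    (p q : ℝ≥0∞) (b : ℝ) (x : I → X) : Prop :=
  lzSeqNorm p q b x < ∞

end

/-! Write p = p₀, r = p₀' and x for the family of Fourier coefficients of f. Everything is measured
on dyadic scales, with β_i = 2^{i/r} x*_{2^i} and δ_i = 2^{-(i+1)/p} f*(2^{-(i+1)}); the logarithmic
weights then become powers of i + 1.

Fourier type on ℝ^d is transferred to the Hausdorff–Young inequality L^p(𝕋^d; X) → ℓ^r(ℤ^d; X)
(`HasFourierType.exists_mFourierCoeff_le`). For a trigonometric polynomial P with coefficients c_n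
one takes g = ∑ c_n φ(· - n), with φ a bump supported in a ball of radius 1/2. Its inverse transform
is the inverse transform of φ times P. On disjoint balls g is equal to c_n, so ‖g‖_r controls the
ℓ^r norm of c, while decay and periodicity bound the other side by ‖P‖_{L^p(𝕋^d)}. Density of the
polynomials does the rest.

Splitting f at height f*(2^{-j}), the high part has coefficients bounded by its L¹ norm and the low
part is handled by Hausdorff–Young. This gives `HasFourierType.exists_dyadic_le`: for all j,
(∑_{i≤j} β_i^r)^{1/r} ≤ C (∑_k 2^{-k/r} δ_{j+k} + (∑_{i≤j} δ_i^p)^{1/p}). Keeping the whole partial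
sum on the left, rather than β_j alone, is what yields the exponent 1/max{p₀', q}.

For q < ∞, take the ℓ^q norm in j with weight (j+1)^b. As b < -1/q, the weight (j+1)^{bq} is
summable, and Hardy's inequality (`exists_tsum_natWeight_mul_rpow_sum_le`) bounds the last term at
the cost of the power 1/min{p, q}. The reverse Hardy inequality
(`exists_tsum_natWeight_mul_rpow_le`) gains the power 1/max{r, q} on the left. The geometric average
is harmless. For q = ∞ the suprema are estimated directly. -/

/-- The weight `(j + 1)^a`. -/
noncomputable def natWeight (a : ℝ) (j : ℕ) : ℝ≥0∞ := ((j : ℝ≥0∞) + 1) ^ a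

/-! ### Power weights on ℕ and their sums -/

section natWeight

lemma natWeight_ne_zero (a : ℝ) (j : ℕ) : natWeight a j ≠ 0 := by
  have h : (j : ℝ≥0∞) + 1 ≠ ∞ := by finiteness
  simp [natWeight, ENNReal.rpow_eq_zero_iff, h]

lemma natWeight_ne_top (a : ℝ) (j : ℕ) : natWeight a j ≠ ∞ := by
  have h : (j : ℝ≥0∞) + 1 ≠ ∞ := by finiteness
  simp [natWeight, ENNReal.rpow_eq_top_iff, h]

lemma natWeight_add (a b : ℝ) (j : ℕ) :
    natWeight (a + b) j = natWeight a j * natWeight b j :=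
  ENNReal.rpow_add _ _ (by simp) (by finiteness)

lemma natWeight_zero (j : ℕ) : natWeight 0 j = 1 := by simp [natWeight]

lemma natWeight_one (j : ℕ) : natWeight 1 j = j + 1 := by simp [natWeight]

lemma natWeight_rpow (a s : ℝ) (j : ℕ) : natWeight a j ^ s = natWeight (a * s) j :=
  (ENNReal.rpow_mul _ _ _).symm

lemma natWeight_eq_ofReal (a : ℝ) (j : ℕ) :
    natWeight a j = ENNReal.ofReal (((j : ℝ) + 1) ^ a) := by
  rw [← ENNReal.ofReal_rpow_of_pos (by positivity), natWeight,
    ENNReal.ofReal_add (by positivity) zero_le_one]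
  simp

lemma natWeight_mono {a b : ℝ} (h : a ≤ b) (j : ℕ) : natWeight a j ≤ natWeight b j :=
  ENNReal.rpow_le_rpow_of_exponent_le (by simp) h

lemma natWeight_le_add {a : ℝ} (ha : 0 ≤ a) (i k : ℕ) : natWeight a i ≤ natWeight a (i + k) := by
  apply ENNReal.rpow_le_rpow _ ha
  push_cast
  gcongr
  simp

/-- Because i + 1 ≤ i + k + 1 ≤ (i + 1)(k + 1), shifting the index by k changes a power weight, in
either direction, by at most (k + 1)^|a|. Geometric factors in k absorb this loss. -/
lemma natWeight_add_index_le (a : ℝ) (i k : ℕ) :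
    natWeight a (i + k) ≤ natWeight |a| k * natWeight a i := by
  rw [natWeight_eq_ofReal, natWeight_eq_ofReal, natWeight_eq_ofReal,
    ← ENNReal.ofReal_mul (by positivity)]
  apply ENNReal.ofReal_le_ofReal
  push_cast
  rcases le_total 0 a with h | h
  · rw [abs_of_nonneg h, ← Real.mul_rpow (by positivity) (by positivity)]
    apply Real.rpow_le_rpow (by positivity) _ h
    have : (0 : ℝ) ≤ i * k := by positivity
    nlinarith
  · calc ((i : ℝ) + k + 1) ^ a ≤ (i + 1) ^ a :=
          Real.rpow_le_rpow_of_nonpos (by positivity) (by linarith [k.cast_nonneg (α := ℝ)]) h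
      _ ≤ _ := le_mul_of_one_le_left (by positivity)
          (Real.one_le_rpow (by linarith [k.cast_nonneg (α := ℝ)]) (abs_nonneg a))

lemma natWeight_le_add_index (a : ℝ) (i k : ℕ) :
    natWeight a i ≤ natWeight |a| k * natWeight a (i + k) := by
  rw [natWeight_eq_ofReal, natWeight_eq_ofReal, natWeight_eq_ofReal,
    ← ENNReal.ofReal_mul (by positivity)]
  apply ENNReal.ofReal_le_ofReal
  push_cast
  have hi := i.cast_nonneg (α := ℝ)
  have hk := k.cast_nonneg (α := ℝ)
  rcases le_total 0 a with h | h
  · calc ((i : ℝ) + 1) ^ a ≤ (i + k + 1) ^ a :=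
          Real.rpow_le_rpow (by positivity) (by linarith) h
      _ ≤ _ := le_mul_of_one_le_left (by positivity)
          (Real.one_le_rpow (by linarith) (abs_nonneg a))
  · rw [abs_of_nonpos h]
    have key : ((i : ℝ) + k + 1) ^ (-a) ≤ (k + 1) ^ (-a) * (i + 1) ^ (-a) := by
      rw [← Real.mul_rpow (by positivity) (by positivity)]
      apply Real.rpow_le_rpow (by positivity) _ (by linarith)
      nlinarith [mul_nonneg hi hk]
    rw [Real.rpow_neg (by positivity), Real.rpow_neg (by positivity)] at key
    rw [Real.rpow_neg (by positivity)] at key ⊢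
    have h1 : 0 < ((i : ℝ) + 1) ^ a := by positivity
    have h2 : 0 < ((k : ℝ) + 1) ^ a := by positivity
    have h3 : 0 < ((i : ℝ) + k + 1) ^ a := by positivity
    field_simp at key ⊢
    linarith

/-- Discrete form of ∫_x^∞ s^{-m} ds: each term is dominated by a difference of consecutive values
of x^{1-m}, and the sum telescopes. -/
lemma exists_tsum_natWeight_le {m : ℝ} (hm : 1 < m) :
    ∃ C : ℝ≥0, ∀ i, ∑' k, natWeight (-m) (i + k) ≤ C * natWeight (1 - m) i := by
  have key : ∀ x : ℝ, 1 ≤ x →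
      x ^ (-m) ≤ 2 ^ m / (m - 1) * (x ^ (1 - m) - (x + 1) ^ (1 - m)) := by
    intro x hx
    have hx0 : 0 < x := by linarith
    have h1 : 1 + (m - 1) * (x + 1)⁻¹ ≤ (x / (x + 1)) ^ (1 - m) := by
      have hlog : Real.log (x / (x + 1)) ≤ - (x + 1)⁻¹ := by
        have := Real.log_le_sub_one_of_pos (show 0 < x / (x + 1) by positivity)
        have e : x / (x + 1) - 1 = -(x + 1)⁻¹ := by field_simp; ring
        linarith
      rw [Real.rpow_def_of_pos (by positivity)]
      calc _ ≤ Real.exp ((m - 1) * (x + 1)⁻¹) := by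
            linarith [Real.add_one_le_exp ((m - 1) * (x + 1)⁻¹)]
        _ ≤ _ := by
            apply Real.exp_le_exp.2
            nlinarith
    rw [Real.div_rpow hx0.le (by positivity), le_div_iff₀ (by positivity)] at h1
    have h2 : (x + 1)⁻¹ * (x + 1) ^ (1 - m) = (x + 1) ^ (-m) := by
      rw [show (1 - m) = 1 + -m by ring, Real.rpow_add (by positivity), Real.rpow_one]
      field_simp
    have h3 : (m - 1) * (x + 1) ^ (-m) ≤ x ^ (1 - m) - (x + 1) ^ (1 - m) := by
      rw [← h2]; linarith
    -- Passing from (x+1)^{-m} back to x^{-m} uses x + 1 ≤ 2x and costs the factor 2^m in the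
    -- constant.
    have h4 : (2 * x) ^ (-m) ≤ (x + 1) ^ (-m) :=
      Real.rpow_le_rpow_of_nonpos (by positivity) (by linarith) (by linarith)
    rw [Real.mul_rpow (by norm_num) hx0.le, Real.rpow_neg (by norm_num)] at h4
    have h5 : 0 < (2 : ℝ) ^ m := by positivity
    have hm' : 0 < m - 1 := by linarith
    rw [div_mul_eq_mul_div, le_div_iff₀ hm']
    calc x ^ (-m) * (m - 1) = 2 ^ m * ((m - 1) * ((2 ^ m)⁻¹ * x ^ (-m))) := by field_simp
      _ ≤ 2 ^ m * ((m - 1) * (x + 1) ^ (-m)) := by gcongr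
      _ ≤ _ := by gcongr
  set D : ℝ := 2 ^ m / (m - 1) with hD
  have hD0 : 0 ≤ D := by
    have : 0 < m - 1 := by linarith
    positivity
  refine ⟨D.toNNReal, fun i => ?_⟩
  apply ENNReal.tsum_le_of_sum_range_le
  intro n
  simp_rw [natWeight_eq_ofReal]
  rw [← ENNReal.ofReal_sum_of_nonneg (fun k _ => by positivity), ENNReal.ofNNReal_toNNReal,
    ← ENNReal.ofReal_mul hD0]
  apply ENNReal.ofReal_le_ofReal
  have : ∀ n : ℕ, ∑ k ∈ Finset.range n, (((i + k : ℕ) : ℝ) + 1) ^ (-m) ≤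
      D * (((i : ℝ) + 1) ^ (1 - m) - (((i + n : ℕ) : ℝ) + 1) ^ (1 - m)) := by
    intro n
    induction n with
    | zero => simp
    | succ n ih =>
      rw [Finset.sum_range_succ]
      have := key (((i + n : ℕ) : ℝ) + 1) (by linarith [(i + n).cast_nonneg (α := ℝ)])
      have e : (((i + (n + 1) : ℕ) : ℝ) + 1) = (((i + n : ℕ) : ℝ) + 1) + 1 := by push_cast; ring
      rw [e]
      linarith
  refine (this n).trans ?_
  gcongr
  have : 0 ≤ (((i + n : ℕ) : ℝ) + 1) ^ (1 - m) := by positivity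
  linarith

/-- The first i + 1 terms of the tail suffice: there i + k + 1 ≤ 2(i + 1), so each is at least
2^{-m} (i+1)^{-m}. -/
lemma exists_natWeight_le_tsum {m : ℝ} (hm : 0 ≤ m) :
    ∃ C : ℝ≥0, ∀ i, natWeight (1 - m) i ≤ C * ∑' k, natWeight (-m) (i + k) := by
  refine ⟨(2 : ℝ≥0) ^ m, fun i => ?_⟩
  have h1 : ∀ k ∈ Finset.range (i + 1), (2 : ℝ≥0∞) ^ (-m) * natWeight (-m) i ≤
      natWeight (-m) (i + k) := by
    intro k hk
    rw [natWeight, natWeight, ENNReal.rpow_neg, ENNReal.rpow_neg, ENNReal.rpow_neg,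
      ← ENNReal.mul_inv (by simp) (by simp), ← ENNReal.mul_rpow_of_nonneg _ _ hm]
    gcongr
    have : i + k + 1 ≤ 2 * (i + 1) := by
      have := Finset.mem_range.1 hk; omega
    exact_mod_cast this
  have h2 := Finset.sum_le_sum h1
  rw [Finset.sum_const, Finset.card_range, nsmul_eq_mul] at h2
  rw [show (1 - m) = 1 + -m by ring, natWeight_add, natWeight_one]
  have h3 : ((2 : ℝ≥0) ^ m : ℝ≥0) * (2 : ℝ≥0∞) ^ (-m) = 1 := by
    rw [ENNReal.coe_rpow_of_nonneg _ hm, ENNReal.rpow_neg]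
    exact ENNReal.mul_inv_cancel (by simp) (by simp)
  calc ((i : ℝ≥0∞) + 1) * natWeight (-m) i
      = ((2 : ℝ≥0) ^ m : ℝ≥0) * (((i + 1 : ℕ) : ℝ≥0∞) * ((2 : ℝ≥0∞) ^ (-m) * natWeight (-m) i)) := by
        rw [mul_left_comm, ← mul_assoc _ _ (natWeight (-m) i), h3, one_mul]; push_cast; rfl
    _ ≤ _ := by
      gcongr
      exact h2.trans (ENNReal.sum_le_tsum _)

/-- For ε ≥ 1 the last term is the largest. For ε ≤ 1 Bernoulli's inequality bounds x^{ε-1} by ε⁻¹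
(x^ε - (x-1)^ε), and the sum telescopes. -/
lemma exists_sum_natWeight_le {ε : ℝ} (hε : 0 < ε) :
    ∃ C : ℝ≥0, ∀ j, ∑ i ∈ Finset.range (j + 1), natWeight (ε - 1) i ≤ C * natWeight ε j := by
  rcases le_total 1 ε with h | h
  · refine ⟨1, fun j => ?_⟩
    calc ∑ i ∈ Finset.range (j + 1), natWeight (ε - 1) i
        ≤ ∑ i ∈ Finset.range (j + 1), natWeight (ε - 1) j := by
          apply Finset.sum_le_sum
          intro i hi
          obtain ⟨k, rfl⟩ := Nat.exists_eq_add_of_le (Nat.lt_succ_iff.1 (Finset.mem_range.1 hi))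
          exact natWeight_le_add (by linarith) i k
      _ = natWeight ε j := by
          rw [Finset.sum_const, Finset.card_range, nsmul_eq_mul]
          conv_rhs => rw [show ε = 1 + (ε - 1) by ring, natWeight_add, natWeight_one]
          push_cast; rfl
      _ = _ := by simp
  · have key : ∀ x : ℝ, 1 ≤ x → x ^ (ε - 1) ≤ ε⁻¹ * (x ^ ε - (x - 1) ^ ε) := by
      intro x hx
      have hx0 : 0 < x := by linarith
      have h1 := _root_.rpow_one_add_le_one_add_mul_self (s := -x⁻¹)
        (by rw [neg_le_neg_iff]; exact inv_le_one_of_one_le₀ hx) hε.le h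
      have e : 1 + -x⁻¹ = (x - 1) / x := by field_simp; ring
      rw [e, Real.div_rpow (by linarith) hx0.le, div_le_iff₀ (by positivity)] at h1
      have e2 : x ^ (ε - 1) = x⁻¹ * x ^ ε := by
        rw [Real.rpow_sub hx0, Real.rpow_one]; field_simp
      rw [e2, le_inv_mul_iff₀ hε]
      nlinarith
    refine ⟨(ε⁻¹).toNNReal, fun j => ?_⟩
    simp_rw [natWeight_eq_ofReal]
    rw [← ENNReal.ofReal_sum_of_nonneg (fun k _ => by positivity), ENNReal.ofNNReal_toNNReal,
      ← ENNReal.ofReal_mul (by positivity)]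
    apply ENNReal.ofReal_le_ofReal
    induction j with
    | zero =>
      have := key 1 le_rfl
      simp [Real.zero_rpow hε.ne'] at this ⊢
      exact this
    | succ j ih =>
      rw [Finset.sum_range_succ]
      have := key (((j + 1 : ℕ) : ℝ) + 1) (by linarith [(j + 1).cast_nonneg (α := ℝ)])
      have e : (((j + 1 : ℕ) : ℝ) + 1) - 1 = (j : ℝ) + 1 := by push_cast; ring
      rw [e] at this
      linarith

lemma tsum_pow_mul_natWeight_lt_top {ρ : ℝ≥0} (hρ : ρ < 1) (a : ℝ) :
    ∑' k, (ρ : ℝ≥0∞) ^ k * natWeight a k < ∞ := by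
  obtain ⟨n, hn⟩ := exists_nat_ge a
  have hs : Summable fun k : ℕ => ((k : ℝ) + 1) ^ n * (ρ : ℝ) ^ (k + 1) := by
    have := summable_pow_mul_geometric_of_norm_lt_one n (r := (ρ : ℝ)) (by simpa using hρ)
    have := (summable_nat_add_iff 1).2 this
    simpa using this
  rcases eq_or_ne ρ 0 with rfl | h0
  · rw [tsum_eq_single 0 (by intro k hk; simp [hk])]
    simpa using (natWeight_ne_top a 0).lt_top
  have hs' : Summable fun k : ℕ => (ρ : ℝ) ^ k * ((k : ℝ) + 1) ^ n := by
    have := hs.mul_left (ρ : ℝ)⁻¹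
    refine this.congr fun k => ?_
    have : (ρ : ℝ) ≠ 0 := by exact_mod_cast h0
    field_simp
    ring
  refine lt_of_le_of_lt (ENNReal.tsum_le_tsum (g := fun k : ℕ =>
    ENNReal.ofReal ((ρ : ℝ) ^ k * ((k : ℝ) + 1) ^ n)) fun k => ?_) hs'.tsum_ofReal_lt_top
  rw [ENNReal.ofReal_mul (by positivity), ENNReal.ofReal_pow (by positivity)]
  gcongr
  · simp
  · rw [← Real.rpow_natCast, ← natWeight_eq_ofReal]
    exact natWeight_mono hn k

end natWeight

/-! ### Hardy's inequality, its converse, and geometric averages in weighted sequence spaces -/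

section Hardy

/-- Jensen's inequality for the weights w, without normalisation of their total mass. -/
lemma ENNReal.rpow_sum_mul_le {ι : Type*} (s : Finset ι) {p : ℝ} (hp : 1 ≤ p)
    (w f : ι → ℝ≥0∞) :
    (∑ i ∈ s, w i * f i) ^ p ≤ (∑ i ∈ s, w i) ^ (p - 1) * ∑ i ∈ s, w i * f i ^ p := by
  have h := ENNReal.inner_le_weight_mul_Lp_of_nonneg s hp w f
  have hp0 : 0 < p := by linarith
  calc _ ≤ ((∑ i ∈ s, w i) ^ (1 - p⁻¹) * (∑ i ∈ s, w i * f i ^ p) ^ p⁻¹) ^ p := by gcongr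
    _ = _ := by
      rw [ENNReal.mul_rpow_of_nonneg _ _ hp0.le, ← ENNReal.rpow_mul, ← ENNReal.rpow_mul,
        inv_mul_cancel₀ hp0.ne', ENNReal.rpow_one]
      congr 2
      field_simp

lemma ENNReal.rpow_tsum_mul_le {ι : Type*} {p : ℝ} (hp : 1 ≤ p) (w f : ι → ℝ≥0∞) :
    (∑' i, w i * f i) ^ p ≤ (∑' i, w i) ^ (p - 1) * ∑' i, w i * f i ^ p := by
  have hp0 : 0 < p := by linarith
  rw [← ENNReal.le_rpow_inv_iff hp0]
  rw [ENNReal.tsum_eq_iSup_sum]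
  refine iSup_le fun s => ?_
  rw [ENNReal.le_rpow_inv_iff hp0]
  refine (ENNReal.rpow_sum_mul_le s hp w f).trans ?_
  exact mul_le_mul' (ENNReal.rpow_le_rpow (ENNReal.sum_le_tsum s) (by linarith))
    (ENNReal.sum_le_tsum s)

lemma ENNReal.tsum_sum_range_succ_comm (F : ℕ → ℕ → ℝ≥0∞) :
    ∑' j, ∑ i ∈ Finset.range (j + 1), F i j = ∑' i, ∑' k, F i (i + k) := by
  have h1 : ∀ j, ∑ i ∈ Finset.range (j + 1), F i j = ∑' i, if i ≤ j then F i j else 0 := by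
    intro j
    rw [tsum_eq_sum (s := Finset.range (j + 1))]
    · apply Finset.sum_congr rfl
      intro i hi
      rw [if_pos (Nat.lt_succ_iff.1 (Finset.mem_range.1 hi))]
    · intro i hi
      rw [if_neg]
      simpa using hi
  simp_rw [h1]
  rw [ENNReal.tsum_comm]
  congr 1
  ext i
  have hinj : Function.Injective (fun k : ℕ => i + k) := add_right_injective i
  rw [← hinj.tsum_eq]
  · simp
  · intro j hj
    have : i ≤ j := by
      by_contra h
      simp [h] at hj
    exact ⟨j - i, by simp [this]⟩

lemma ENNReal.rpow_sum_le_sum_rpow {ι : Type*} (s : Finset ι) (f : ι → ℝ≥0∞) {p : ℝ}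
    (hp : 0 < p) (hp1 : p ≤ 1) : (∑ i ∈ s, f i) ^ p ≤ ∑ i ∈ s, f i ^ p := by
  classical
  induction s using Finset.induction_on with
  | empty => simp [hp]
  | insert a s ha ih =>
    rw [Finset.sum_insert ha, Finset.sum_insert ha]
    exact (ENNReal.rpow_add_le_add_rpow _ _ hp.le hp1).trans (by gcongr)

lemma ENNReal.sum_rpow_le_rpow_sum {ι : Type*} (s : Finset ι) (f : ι → ℝ≥0∞) {p : ℝ}
    (hp : 1 ≤ p) : ∑ i ∈ s, f i ^ p ≤ (∑ i ∈ s, f i) ^ p := by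
  classical
  induction s using Finset.induction_on with
  | empty => simp [show 0 < p by linarith]
  | insert a s ha ih =>
    rw [Finset.sum_insert ha, Finset.sum_insert ha]
    exact le_trans (by gcongr) (ENNReal.add_rpow_le_rpow_add _ _ hp)

/-- Hardy's inequality with power weights. -/
lemma exists_tsum_natWeight_mul_rpow_sum_le {m r : ℝ} (hm : 1 < m) (hr : 0 < r) :
    ∃ C : ℝ≥0, ∀ γ : ℕ → ℝ≥0∞,
      ∑' j, natWeight (-m) j * (∑ i ∈ Finset.range (j + 1), γ i) ^ r ≤
        C * ∑' j, natWeight (-m + max r 1) j * γ j ^ r := by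
  rcases le_total r 1 with h | h
  · obtain ⟨C, hC⟩ := exists_tsum_natWeight_le hm
    refine ⟨C, fun γ => ?_⟩
    rw [max_eq_right h]
    calc _ ≤ ∑' j, ∑ i ∈ Finset.range (j + 1), natWeight (-m) j * γ i ^ r := by
          gcongr with j
          rw [← Finset.mul_sum]
          gcongr
          exact ENNReal.rpow_sum_le_sum_rpow _ _ hr h
      _ = ∑' i, (∑' k, natWeight (-m) (i + k)) * γ i ^ r := by
          rw [ENNReal.tsum_sum_range_succ_comm]
          simp_rw [ENNReal.tsum_mul_right]
      _ ≤ ∑' i, C * (natWeight (-m + 1) i * γ i ^ r) := by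
          refine ENNReal.tsum_le_tsum fun i => ?_
          rw [← mul_assoc, neg_add_eq_sub]
          gcongr
          exact hC i
      _ = _ := ENNReal.tsum_mul_left
  · rw [max_eq_left h]
    -- Jensen is applied with weights (i+1)^{ε-1}, whose partial sums grow like (j+1)^ε. Taking ε
    -- small keeps the resulting tail exponent m - ε(r-1) above 1.
    obtain ⟨ε, hε, hε'⟩ : ∃ ε : ℝ, 0 < ε ∧ 1 < m - ε * (r - 1) := by
      refine ⟨(m - 1) / (2 * r), by apply div_pos <;> linarith, ?_⟩
      have : (m - 1) / (2 * r) * (r - 1) ≤ (m - 1) / 2 := by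
        rw [div_mul_eq_mul_div, div_le_div_iff₀ (by positivity) (by norm_num)]
        nlinarith
      linarith
    obtain ⟨C₁, hC₁⟩ := exists_sum_natWeight_le hε
    obtain ⟨C₂, hC₂⟩ := exists_tsum_natWeight_le hε'
    refine ⟨C₁ ^ (r - 1) * C₂, fun γ => ?_⟩
    have step : ∀ j, (∑ i ∈ Finset.range (j + 1), γ i) ^ r ≤
        C₁ ^ (r - 1) * natWeight (ε * (r - 1)) j *
          ∑ i ∈ Finset.range (j + 1), natWeight ((1 - ε) * (r - 1)) i * γ i ^ r := by
      intro j
      have e : ∀ i, γ i = natWeight (ε - 1) i * (natWeight (1 - ε) i * γ i) := by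
        intro i
        rw [← mul_assoc, ← natWeight_add]
        simp [natWeight_zero]
      calc (∑ i ∈ Finset.range (j + 1), γ i) ^ r
          = (∑ i ∈ Finset.range (j + 1),
              natWeight (ε - 1) i * (natWeight (1 - ε) i * γ i)) ^ r := by
            congr 1; exact Finset.sum_congr rfl fun i _ => e i
        _ ≤ _ := ENNReal.rpow_sum_mul_le _ h _ _
        _ ≤ (C₁ * natWeight ε j) ^ (r - 1) * _ := by
            exact mul_le_mul' (ENNReal.rpow_le_rpow (hC₁ j) (by linarith)) le_rfl
        _ = _ := by
            rw [ENNReal.mul_rpow_of_nonneg _ _ (by linarith), natWeight_rpow]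
            congr 1
            refine Finset.sum_congr rfl fun i _ => ?_
            rw [ENNReal.mul_rpow_of_nonneg _ _ hr.le, natWeight_rpow, ← mul_assoc, ← natWeight_add]
            congr 2
            ring
    calc _ ≤ ∑' j, natWeight (-m) j * (C₁ ^ (r - 1) * natWeight (ε * (r - 1)) j *
          ∑ i ∈ Finset.range (j + 1), natWeight ((1 - ε) * (r - 1)) i * γ i ^ r) := by
          gcongr with j
          exact step j
      _ = ∑' j, ∑ i ∈ Finset.range (j + 1), natWeight (-(m - ε * (r - 1))) j *
            (C₁ ^ (r - 1) * (natWeight ((1 - ε) * (r - 1)) i * γ i ^ r)) := by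
          congr 1; ext j
          rw [← Finset.mul_sum, ← Finset.mul_sum,
            show -(m - ε * (r - 1)) = -m + ε * (r - 1) by ring, natWeight_add]
          ring
      _ = ∑' i, (∑' k, natWeight (-(m - ε * (r - 1))) (i + k)) *
            (C₁ ^ (r - 1) * (natWeight ((1 - ε) * (r - 1)) i * γ i ^ r)) := by
          rw [ENNReal.tsum_sum_range_succ_comm]
          simp_rw [ENNReal.tsum_mul_right]
      _ ≤ ∑' i, ((C₁ ^ (r - 1) * C₂ : ℝ≥0) : ℝ≥0∞) * (natWeight (-m + r) i * γ i ^ r) := by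
          refine ENNReal.tsum_le_tsum fun i => ?_
          calc _ ≤ (C₂ * natWeight (1 - (m - ε * (r - 1))) i) *
                  (C₁ ^ (r - 1) * (natWeight ((1 - ε) * (r - 1)) i * γ i ^ r)) := by
                gcongr; exact hC₂ i
            _ = _ := by
                rw [show -m + r = (1 - (m - ε * (r - 1))) + (1 - ε) * (r - 1) by ring,
                  natWeight_add, ENNReal.coe_mul, ENNReal.coe_rpow_of_nonneg _ (by linarith)]
                ring
      _ = _ := ENNReal.tsum_mul_left

/-- The reverse of Hardy's inequality with power weights. -/
lemma exists_tsum_natWeight_mul_rpow_le {m s : ℝ} (hm : 1 < m) (hs : 0 < s) :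
    ∃ C : ℝ≥0, ∀ γ : ℕ → ℝ≥0∞,
      ∑' j, natWeight (-m + min s 1) j * γ j ^ s ≤
        C * ∑' j, natWeight (-m) j * (∑ i ∈ Finset.range (j + 1), γ i) ^ s := by
  obtain ⟨C, hC⟩ := exists_natWeight_le_tsum (m := m) (by linarith)
  -- Summation by parts: the weight (i+1)^{1-m} is bounded by a tail of (j+1)^{-m}, and exchanging
  -- the sums brings in the partial sums of D.
  have main : ∀ D G : ℕ → ℝ≥0∞, (∀ j, ∑ i ∈ Finset.range (j + 1), D i ≤ G j) →
      ∑' i, natWeight (1 - m) i * D i ≤ C * ∑' j, natWeight (-m) j * G j := by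
    intro D G h
    calc _ ≤ ∑' i, C * ((∑' k, natWeight (-m) (i + k)) * D i) := by
          refine ENNReal.tsum_le_tsum fun i => ?_
          rw [← mul_assoc]
          gcongr
          exact hC i
      _ = C * ∑' j, ∑ i ∈ Finset.range (j + 1), natWeight (-m) j * D i := by
          rw [ENNReal.tsum_mul_left, ENNReal.tsum_sum_range_succ_comm]
          simp_rw [ENNReal.tsum_mul_right]
      _ ≤ _ := by
          gcongr with j
          rw [← Finset.mul_sum]
          gcongr
          exact h j
  rcases le_total 1 s with h | h
  · refine ⟨C, fun γ => ?_⟩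
    rw [min_eq_right h, neg_add_eq_sub]
    exact main _ _ fun j => ENNReal.sum_rpow_le_rpow_sum _ _ h
  rw [min_eq_left h]
  -- For s ≤ 1 the power is no longer superadditive. With Γ_j the partial sums, `main` is applied to
  -- D_i = γ_i Γ_i^{s-1}; the summand 1 pays for the term Γ_j^s in `hpt`.
  refine ⟨1 + C * (s⁻¹).toNNReal, fun γ => ?_⟩
  by_cases htop : ∃ i, γ i = ∞
  · obtain ⟨i, hi⟩ := htop
    have : ∑' j, natWeight (-m) j * (∑ i ∈ Finset.range (j + 1), γ i) ^ s = ∞ := by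
      refine ENNReal.tsum_eq_top_of_eq_top ⟨i, ?_⟩
      have : ∑ k ∈ Finset.range (i + 1), γ k = ∞ :=
        ENNReal.sum_eq_top.2 ⟨i, by simp, hi⟩
      rw [this, ENNReal.top_rpow_of_pos hs, ENNReal.mul_top (natWeight_ne_zero _ _)]
    rw [this, ENNReal.mul_top]
    · exact le_top
    · simp
  push Not at htop
  lift γ to ℕ → ℝ≥0 using htop
  set Γ : ℕ → ℝ≥0 := fun j => ∑ i ∈ Finset.range (j + 1), γ i with hΓ
  have hsum : ∀ j, ∑ i ∈ Finset.range (j + 1), (γ i : ℝ≥0∞) = Γ j := fun j => by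
    simp [hΓ]
  have hle : ∀ j, γ j ≤ Γ j := fun j =>
    Finset.single_le_sum (f := γ) (fun _ _ => zero_le) (by simp)
  -- Concavity of the power s: the increment of Γ^s from x to x + y is at least s y (x+y)^{s-1}.
  -- Summation gives ∑_{i≤j} D_i ≤ s⁻¹ Γ_j^s.
  have bern : ∀ x y : ℝ≥0, s⁻¹ * (x : ℝ) ^ s + y * (x + y : ℝ) ^ (s - 1) ≤
      s⁻¹ * (x + y : ℝ) ^ s := by
    intro x y
    rcases eq_or_ne (x + y) 0 with h0 | h0
    · have hx : x = 0 := by simpa using (add_eq_zero.1 h0).1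
      have hy : y = 0 := by simpa using (add_eq_zero.1 h0).2
      simp [hx, hy]
    have hpos : 0 < (x + y : ℝ) := by exact_mod_cast pos_iff_ne_zero.2 h0
    have h1 := _root_.rpow_one_add_le_one_add_mul_self (s := -(y / (x + y) : ℝ))
        (by rw [neg_le_neg_iff, div_le_one hpos]; linarith [x.coe_nonneg]) hs.le h
    have e : 1 + -(y / (x + y) : ℝ) = x / (x + y) := by field_simp; ring
    rw [e, Real.div_rpow x.coe_nonneg hpos.le, div_le_iff₀ (by positivity)] at h1
    have e2 : (x + y : ℝ) ^ (s - 1) = (x + y : ℝ) ^ s / (x + y) := by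
      rw [Real.rpow_sub hpos, Real.rpow_one]
    rw [e2, inv_mul_eq_div, inv_mul_eq_div, ← sub_nonneg]
    have : (x + y : ℝ) ^ s / s - (x ^ s / s + y * ((x + y : ℝ) ^ s / (x + y))) =
       ((1 + s * -(y / (x + y))) * (x + y : ℝ) ^ s - x ^ s) / s := by
      field_simp; ring
    rw [this]
    exact div_nonneg (by linarith) hs.le
  have hD : ∀ j, ∑ i ∈ Finset.range (j + 1), ((γ i : ℝ) * (Γ i : ℝ) ^ (s - 1)) ≤
      s⁻¹ * (Γ j : ℝ) ^ s := by
    intro j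
    induction j with
    | zero =>
      have := bern 0 (γ 0)
      simpa [hΓ, Real.zero_rpow hs.ne'] using this
    | succ j ih =>
      rw [Finset.sum_range_succ]
      have := bern (Γ j) (γ (j + 1))
      have e : (Γ (j + 1) : ℝ) = Γ j + γ (j + 1) := by
        simp only [hΓ]; rw [Finset.sum_range_succ _ (j + 1)]; push_cast; rfl
      rw [e]
      linarith
  have hpt : ∀ j, natWeight s j * (γ j : ℝ≥0∞) ^ s ≤
      (Γ j : ℝ≥0∞) ^ s + natWeight 1 j * ENNReal.ofReal ((γ j : ℝ) * (Γ j : ℝ) ^ (s - 1)) := by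
    intro j
    rcases eq_or_ne (Γ j) 0 with h0 | h0
    · have : γ j = 0 := le_antisymm (h0 ▸ hle j) zero_le
      simp [this, hs]
    have hpos : 0 < (Γ j : ℝ) := by exact_mod_cast pos_iff_ne_zero.2 h0
    have e1 : ∀ x : ℝ≥0, (x : ℝ≥0∞) ^ s = ENNReal.ofReal ((x : ℝ) ^ s) := by
      intro x
      rw [← ENNReal.ofReal_rpow_of_nonneg x.coe_nonneg hs.le]; simp
    rw [e1, e1, natWeight_eq_ofReal, natWeight_eq_ofReal, ← ENNReal.ofReal_mul (by positivity),
      ← ENNReal.ofReal_mul (by positivity), ← ENNReal.ofReal_add (by positivity) (by positivity)]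
    apply ENNReal.ofReal_le_ofReal
    -- The bound t^s ≤ 1 + t for 0 < s ≤ 1, multiplied by Γ_j^s, splits the summand into Γ_j^s and
    -- (j+1) D_j.
    have hT : (((j : ℝ) + 1) * γ j / Γ j) ^ s ≤ 1 + ((j : ℝ) + 1) * γ j / Γ j := by
      set t := ((j : ℝ) + 1) * γ j / Γ j with ht
      have ht0 : 0 ≤ t := by positivity
      calc t ^ s ≤ (1 + t) ^ s := Real.rpow_le_rpow ht0 (by linarith) hs.le
        _ ≤ (1 + t) ^ (1 : ℝ) := Real.rpow_le_rpow_of_exponent_le (by linarith) h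
        _ = _ := Real.rpow_one _
    rw [Real.div_rpow (by positivity) (by positivity), Real.mul_rpow (by positivity) (by positivity),
      div_le_iff₀ (by positivity)] at hT
    refine hT.trans_eq ?_
    rw [Real.rpow_sub hpos, Real.rpow_one, Real.rpow_one]
    field_simp
  have hmain := main (fun j => ENNReal.ofReal ((γ j : ℝ) * (Γ j : ℝ) ^ (s - 1)))
    (fun j => (s⁻¹).toNNReal * (Γ j : ℝ≥0∞) ^ s) (fun j => by
      rw [← ENNReal.ofReal_sum_of_nonneg (fun k _ => by positivity), ENNReal.ofNNReal_toNNReal]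
      have e1 : (Γ j : ℝ≥0∞) ^ s = ENNReal.ofReal ((Γ j : ℝ) ^ s) := by
        rw [← ENNReal.ofReal_rpow_of_nonneg (Γ j).coe_nonneg hs.le]; simp
      rw [e1, ← ENNReal.ofReal_mul (by positivity)]
      exact ENNReal.ofReal_le_ofReal (hD j))
  simp_rw [hsum]
  calc _ ≤ ∑' j, (natWeight (-m) j * (Γ j : ℝ≥0∞) ^ s +
          natWeight (1 - m) j * ENNReal.ofReal ((γ j : ℝ) * (Γ j : ℝ) ^ (s - 1))) := by
        gcongr with j
        rw [natWeight_add, mul_assoc, show 1 - m = -m + 1 by ring, natWeight_add, mul_assoc,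
          ← mul_add]
        gcongr
        exact hpt j
    _ = _ := ENNReal.tsum_add
    _ ≤ ∑' j, natWeight (-m) j * (Γ j : ℝ≥0∞) ^ s +
          C * ∑' j, natWeight (-m) j * ((s⁻¹).toNNReal * (Γ j : ℝ≥0∞) ^ s) := by gcongr
    _ = _ := by
        simp_rw [mul_left_comm _ ((s⁻¹).toNNReal : ℝ≥0∞)]
        rw [ENNReal.tsum_mul_left]
        push_cast
        ring

/-- Jensen with the weights ρ^k moves the power q inside; shifting the weight from j to j + k costs
(k+1)^|a|, which is summable against ρ^k. -/
lemma exists_tsum_natWeight_mul_rpow_tsum_le {q : ℝ} (hq : 1 ≤ q) {ρ : ℝ≥0} (hρ : ρ < 1)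
    {a : ℝ} :
    ∃ C : ℝ≥0, ∀ α : ℕ → ℝ≥0∞,
      ∑' j, natWeight a j * (∑' k, (ρ : ℝ≥0∞) ^ k * α (j + k)) ^ q ≤
        C * ∑' j, natWeight a j * α j ^ q := by
  have hG : ∑' k, (ρ : ℝ≥0∞) ^ k < ∞ := by
    simpa [natWeight_zero] using tsum_pow_mul_natWeight_lt_top hρ 0
  have hH := tsum_pow_mul_natWeight_lt_top hρ |a|
  have hK : (∑' k, (ρ : ℝ≥0∞) ^ k) ^ (q - 1) * ∑' k, (ρ : ℝ≥0∞) ^ k * natWeight |a| k < ∞ :=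
    ENNReal.mul_lt_top (ENNReal.rpow_lt_top_of_nonneg (by linarith) hG.ne) hH
  refine ⟨_, fun α => le_of_le_of_eq ?_ (congrArg (· * _) (ENNReal.coe_toNNReal hK.ne).symm)⟩
  set A := (∑' k, (ρ : ℝ≥0∞) ^ k) ^ (q - 1)
  calc _ ≤ ∑' j, natWeight a j * (A * ∑' k, (ρ : ℝ≥0∞) ^ k * α (j + k) ^ q) := by
        gcongr with j
        exact ENNReal.rpow_tsum_mul_le hq _ _
    _ = A * ∑' k, ∑' j, (ρ : ℝ≥0∞) ^ k * (natWeight a j * α (j + k) ^ q) := by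
        rw [ENNReal.tsum_comm, ← ENNReal.tsum_mul_left]
        congr 1; ext j
        rw [← ENNReal.tsum_mul_left, ← ENNReal.tsum_mul_left, ← ENNReal.tsum_mul_left]
        congr 1; ext k
        ring
    _ ≤ A * ∑' k, (ρ : ℝ≥0∞) ^ k * natWeight |a| k * ∑' j, natWeight a j * α j ^ q := by
        gcongr with k
        rw [ENNReal.tsum_mul_left, mul_assoc]
        gcongr
        calc _ ≤ ∑' j, natWeight |a| k * (natWeight a (j + k) * α (j + k) ^ q) := by
              refine ENNReal.tsum_le_tsum fun j => ?_
              rw [← mul_assoc]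
              gcongr
              exact natWeight_le_add_index a j k
          _ = natWeight |a| k * ∑' j, natWeight a (j + k) * α (j + k) ^ q := ENNReal.tsum_mul_left
          _ ≤ _ := by
              exact mul_le_mul' le_rfl (ENNReal.tsum_comp_le_tsum_of_injective
                (add_left_injective k) (fun j => natWeight a j * α j ^ q))
    _ = _ := by
        rw [ENNReal.tsum_mul_right]
        ring

end Hardy

/-! ### Integration on the torus, lattice points and trigonometric polynomials -/

section Torus

open UnitAddTorus

instance (d : ℕ) : IsProbabilityMeasure (torusMeasure d) := by
  unfold torusMeasure; infer_instance

lemma mFourierCoeff_eq {d : ℕ} {X : Type*} [NormedAddCommGroup X] [NormedSpace ℂ X]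
    (f : UnitAddTorus (Fin d) → X) (n : Fin d → ℤ) :
    mFourierCoeff f n = ∫ t, mFourier (-n) t • f t ∂(torusMeasure d) := rfl

lemma lintegral_torusMeasure {d : ℕ} (f : UnitAddTorus (Fin d) → ℝ≥0∞) (a : Fin d → ℝ) :
    ∫⁻ x, f x ∂(torusMeasure d) =
      ∫⁻ x : Fin d → ℝ in {x | ∀ i, x i ∈ Set.Ioc (a i) (a i + 1)}, f (fun i => x i) :=
  UnitAddTorus.lintegral_preimage f a

lemma iUnion_unitCubes (d : ℕ) :
    ⋃ k : Fin d → ℤ, {x : Fin d → ℝ | ∀ i, x i ∈ Set.Ioc (k i : ℝ) (k i + 1)} = Set.univ := by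
  refine Set.eq_univ_of_forall fun x => Set.mem_iUnion.2 ⟨fun i => ⌈x i⌉ - 1, fun i => ?_⟩
  push_cast
  exact ⟨by linarith [Int.ceil_lt_add_one (x i)], by linarith [Int.le_ceil (x i)]⟩

lemma measurableSet_unitCube {d : ℕ} (a : Fin d → ℝ) :
    MeasurableSet {x : Fin d → ℝ | ∀ i, x i ∈ Set.Ioc (a i) (a i + 1)} := by
  have : {x : Fin d → ℝ | ∀ i, x i ∈ Set.Ioc (a i) (a i + 1)} =
      Set.univ.pi fun i => Set.Ioc (a i) (a i + 1) := by ext; simp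
  rw [this]
  exact MeasurableSet.univ_pi fun i => measurableSet_Ioc

lemma volume_unitCube {d : ℕ} (a : Fin d → ℝ) :
    volume {x : Fin d → ℝ | ∀ i, x i ∈ Set.Ioc (a i) (a i + 1)} = 1 := by
  have : {x : Fin d → ℝ | ∀ i, x i ∈ Set.Ioc (a i) (a i + 1)} =
      Set.univ.pi fun i => Set.Ioc (a i) (a i + 1) := by ext; simp
  rw [this, Real.volume_pi_Ioc]
  simp

lemma pairwise_disjoint_unitCubes (d : ℕ) :
    Pairwise (Function.onFun Disjoint fun k : Fin d → ℤ =>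
      {x : Fin d → ℝ | ∀ i, x i ∈ Set.Ioc (k i : ℝ) (k i + 1)}) := by
  intro k l hkl
  refine Set.disjoint_left.2 fun x hk hl => hkl (funext fun i => ?_)
  have h1 := hk i
  have h2 := hl i
  simp only [Set.mem_Ioc] at h1 h2
  have h3 : (k i : ℝ) < l i + 1 := by linarith
  have h4 : (l i : ℝ) < k i + 1 := by linarith
  have h3' : k i < l i + 1 := by exact_mod_cast h3
  have h4' : l i < k i + 1 := by exact_mod_cast h4
  omega

lemma lintegral_eq_tsum_unitCubes {d : ℕ} (f : (Fin d → ℝ) → ℝ≥0∞) :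
    ∫⁻ x, f x = ∑' k : Fin d → ℤ,
      ∫⁻ x in {x : Fin d → ℝ | ∀ i, x i ∈ Set.Ioc (k i : ℝ) (k i + 1)}, f x := by
  rw [← lintegral_iUnion (fun k => measurableSet_unitCube _) (pairwise_disjoint_unitCubes d),
    iUnion_unitCubes, Measure.restrict_univ]

/-- Integrating a periodic function against a decaying weight. -/
lemma exists_lintegral_mul_periodic_le (d : ℕ) :
    ∃ K : ℝ≥0, ∀ Φ : UnitAddTorus (Fin d) → ℝ≥0∞,
      ∫⁻ x : Fin d → ℝ, ENNReal.ofReal ((1 + ‖x‖) ^ (-((d : ℝ) + 1))) * Φ (fun i => x i) ≤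
        K * ∫⁻ x, Φ x ∂(torusMeasure d) := by
  set W : (Fin d → ℝ) → ℝ≥0∞ := fun x => ENNReal.ofReal ((1 + ‖x‖) ^ (-((d : ℝ) + 1))) with hW
  have hint : ∫⁻ x, W x < ∞ := by
    apply finite_integral_one_add_norm
    simp
  -- The norm is the sup norm, so two points of one unit cube are at distance at most 1, and the
  -- weight varies there by a factor of at most 2^{d+1}.
  have hcomp : ∀ (k : Fin d → ℤ) (x y : Fin d → ℝ),
      (∀ i, x i ∈ Set.Ioc (k i : ℝ) (k i + 1)) → (∀ i, y i ∈ Set.Ioc (k i : ℝ) (k i + 1)) →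
      W x ≤ ENNReal.ofReal (2 ^ ((d : ℝ) + 1)) * W y := by
    intro k x y hx hy
    have hxy : ‖y - x‖ ≤ 1 := by
      rw [pi_norm_le_iff_of_nonneg zero_le_one]
      intro i
      have h1 := hx i
      have h2 := hy i
      simp only [Set.mem_Ioc] at h1 h2
      rw [Pi.sub_apply, Real.norm_eq_abs, abs_le]
      constructor <;> linarith
    have hnorm : ‖y‖ ≤ ‖x‖ + 1 := by
      have := norm_le_norm_add_norm_sub' y x
      linarith
    simp only [hW]
    rw [← ENNReal.ofReal_mul (by positivity)]
    apply ENNReal.ofReal_le_ofReal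
    have h1 : (2 * (1 + ‖x‖)) ^ (-((d : ℝ) + 1)) ≤ (1 + ‖y‖) ^ (-((d : ℝ) + 1)) :=
      Real.rpow_le_rpow_of_nonpos (by positivity) (by linarith [norm_nonneg x]) (by
        have := d.cast_nonneg (α := ℝ)
        linarith)
    rw [Real.mul_rpow (by norm_num) (by positivity), Real.rpow_neg (by norm_num)] at h1
    rwa [inv_mul_le_iff₀ (by positivity)] at h1
  set c := ENNReal.ofReal (2 ^ ((d : ℝ) + 1)) with hc
  refine ⟨(c * ∫⁻ x, W x).toNNReal, fun Φ => ?_⟩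
  rw [ENNReal.coe_toNNReal (ENNReal.mul_lt_top ENNReal.ofReal_lt_top hint).ne,
    lintegral_eq_tsum_unitCubes, lintegral_eq_tsum_unitCubes W, ← ENNReal.tsum_mul_left,
    ← ENNReal.tsum_mul_right]
  refine ENNReal.tsum_le_tsum fun k => ?_
  -- The cube has volume 1, so W on it is bounded by c times its integral over the cube; these
  -- integrals add up to ∫ W.
  have hWk : ∀ x ∈ {x : Fin d → ℝ | ∀ i, x i ∈ Set.Ioc (k i : ℝ) (k i + 1)},
      W x ≤ c * ∫⁻ y in {x : Fin d → ℝ | ∀ i, x i ∈ Set.Ioc (k i : ℝ) (k i + 1)}, W y := by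
    intro x hx
    calc W x = ∫⁻ y in {x : Fin d → ℝ | ∀ i, x i ∈ Set.Ioc (k i : ℝ) (k i + 1)}, W x := by
          rw [setLIntegral_const, volume_unitCube, mul_one]
      _ ≤ ∫⁻ y in {x : Fin d → ℝ | ∀ i, x i ∈ Set.Ioc (k i : ℝ) (k i + 1)}, c * W y :=
          setLIntegral_mono' (measurableSet_unitCube _) fun y hy => hcomp k x y hx hy
      _ = _ := lintegral_const_mul' _ _ ENNReal.ofReal_ne_top
  rw [lintegral_torusMeasure Φ (fun i => (k i : ℝ)), ← lintegral_const_mul' _ _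
    (ENNReal.mul_lt_top ENNReal.ofReal_lt_top
      (lt_of_le_of_lt (setLIntegral_le_lintegral _ _) hint)).ne]
  exact setLIntegral_mono' (measurableSet_unitCube _) fun x hx => by
    gcongr
    exact hWk x hx

/-- The lattice point of `ℝ^d` with integer coordinates `n`. -/
noncomputable def latticePoint {d : ℕ} (n : Fin d → ℤ) : EuclideanSpace ℝ (Fin d) :=
  WithLp.toLp 2 fun i => (n i : ℝ)

lemma one_le_dist_latticePoint {d : ℕ} {m n : Fin d → ℤ} (h : m ≠ n) :
    1 ≤ dist (latticePoint m) (latticePoint n) := by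
  obtain ⟨i, hi⟩ := Function.ne_iff.1 h
  have h1 : (1 : ℝ) ≤ |(m i : ℝ) - n i| := by
    have : 1 ≤ |m i - n i| := Int.one_le_abs (sub_ne_zero.2 hi)
    exact_mod_cast this
  have h2 := PiLp.norm_apply_le (latticePoint m - latticePoint n) i
  rw [dist_eq_norm]
  refine h1.trans (le_trans (le_of_eq ?_) h2)
  simp [latticePoint]

lemma mFourier_eq_exp {d : ℕ} (n : Fin d → ℤ) (x : EuclideanSpace ℝ (Fin d)) :
    mFourier n (fun i => (x i : UnitAddCircle)) =
      Complex.exp (↑(2 * Real.pi * inner ℝ (latticePoint n) x) * Complex.I) := by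
  simp only [mFourier, ContinuousMap.coe_mk, fourier_coe_apply, PiLp.inner_apply, latticePoint]
  rw [← Complex.exp_sum]
  congr 1
  push_cast
  rw [Finset.mul_sum, Finset.sum_mul]
  refine Finset.sum_congr rfl fun i _ => ?_
  simp
  ring

/-- The trigonometric polynomial with coefficients `c`. -/
noncomputable def trigPoly {d : ℕ} {X : Type*} [NormedAddCommGroup X] [NormedSpace ℂ X]
    (c : (Fin d → ℤ) →₀ X) (x : UnitAddTorus (Fin d)) : X :=
  c.sum fun n y => mFourier n x • y

variable {d : ℕ} {X : Type*} [NormedAddCommGroup X] [NormedSpace ℂ X]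

lemma continuous_trigPoly (c : (Fin d → ℤ) →₀ X) : Continuous (trigPoly c) := by
  unfold trigPoly Finsupp.sum
  fun_prop

lemma trigPoly_add (c c' : (Fin d → ℤ) →₀ X) :
    trigPoly (c + c') = trigPoly c + trigPoly c' := by
  classical
  ext x
  exact Finsupp.sum_add_index' (by simp) (by simp)

lemma integral_mFourier_neg_mul_mFourier (m n : Fin d → ℤ) :
    ∫ t, mFourier (-m) t * mFourier n t ∂(torusMeasure d) = if m = n then 1 else 0 := by
  classical
  have h := orthonormal_iff_ite.1 (orthonormal_mFourier (d := Fin d)) m n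
  rw [ContinuousMap.inner_toLp] at h
  rw [← h]
  refine integral_congr_ae (Filter.Eventually.of_forall fun t => ?_)
  simp [mFourier_neg, mul_comm]

lemma mFourierCoeff_trigPoly [CompleteSpace X] (c : (Fin d → ℤ) →₀ X) (n : Fin d → ℤ) :
    mFourierCoeff (trigPoly c) n = c n := by
  classical
  rw [mFourierCoeff_eq]
  simp only [trigPoly, Finsupp.sum, Finset.smul_sum, smul_smul]
  rw [integral_finsetSum]
  · simp_rw [integral_smul_const, integral_mFourier_neg_mul_mFourier]
    by_cases h : c n = 0
    · rw [h]
      refine Finset.sum_eq_zero fun i hi => ?_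
      rcases eq_or_ne n i with rfl | hni
      · simp [h]
      · simp [hni]
    · rw [Finset.sum_eq_single n]
      · simp
      · intro i _ hi
        simp [hi.symm]
      · intro hn
        simp at hn
        simp [hn]
  · intro i _
    apply Continuous.integrable_of_hasCompactSupport
    · fun_prop
    · exact HasCompactSupport.of_compactSpace _

end Torus

/-! ### From Fourier type on ℝ^d to Hausdorff–Young on the torus -/

section Transference

open UnitAddTorus

variable {d : ℕ} {X : Type*} [NormedAddCommGroup X] [NormedSpace ℂ X]

/-- A smooth bump function supported in a ball of radius `1 / 2`. -/
noncomputable def halfBump (d : ℕ) : ContDiffBump (0 : EuclideanSpace ℝ (Fin d)) :=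
  ⟨1 / 4, 1 / 2, by norm_num, by norm_num⟩

/-- The complex-valued Schwartz function given by `halfBump`. -/
noncomputable def halfBumpSchwartz (d : ℕ) : 𝓢(EuclideanSpace ℝ (Fin d), ℂ) :=
  HasCompactSupport.toSchwartzMap (f := fun v => ((halfBump d v : ℝ) : ℂ))
    ((halfBump d).hasCompactSupport.comp_left (g := ((↑) : ℝ → ℂ)) Complex.ofReal_zero)
    (Complex.ofRealCLM.contDiff.comp (halfBump d).contDiff)

lemma halfBumpSchwartz_apply (v : EuclideanSpace ℝ (Fin d)) :
    halfBumpSchwartz d v = ((halfBump d v : ℝ) : ℂ) := rfl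

/-- Translates of a bump function with vector coefficients. -/
noncomputable def bumpSum (c : (Fin d → ℤ) →₀ X) (v : EuclideanSpace ℝ (Fin d)) : X :=
  c.sum fun n y => halfBumpSchwartz d (v - latticePoint n) • y

lemma hasCompactSupport_bumpSum (c : (Fin d → ℤ) →₀ X) : HasCompactSupport (bumpSum c) := by
  refine HasCompactSupport.intro
    (c.support.isCompact_biUnion fun n _ => isCompact_closedBall (latticePoint n) (1 / 2))
    fun v hv => Finset.sum_eq_zero fun n hn => ?_
  have hvn : v ∉ Metric.closedBall (latticePoint n) (1 / 2) := fun h =>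
    hv (Set.mem_biUnion (Finset.mem_coe.2 hn) h)
  beta_reduce
  rw [halfBumpSchwartz_apply, (halfBump d).zero_of_le_dist, Complex.ofReal_zero, zero_smul]
  rw [dist_zero_right, ← dist_eq_norm]
  rw [Metric.mem_closedBall, not_le] at hvn
  exact hvn.le

lemma contDiff_bumpSum (c : (Fin d → ℤ) →₀ X) : ContDiff ℝ (⊤ : ℕ∞) (bumpSum c) := by
  unfold bumpSum Finsupp.sum
  refine ContDiff.sum fun n _ => ContDiff.smul ?_ contDiff_const
  exact ((halfBumpSchwartz d).smooth _).comp (contDiff_id.sub contDiff_const)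

/-- `bumpSum` as a Schwartz function. -/
noncomputable def bumpSumSchwartz (c : (Fin d → ℤ) →₀ X) : 𝓢(EuclideanSpace ℝ (Fin d), X) :=
  (hasCompactSupport_bumpSum c).toSchwartzMap (contDiff_bumpSum c)

/-- A point within 1/4 of n is at distance more than 1/2 from every other lattice point, so only the
bump centred at n contributes, and it equals 1 there. -/
lemma bumpSum_eq_of_mem_ball (c : (Fin d → ℤ) →₀ X) (n : Fin d → ℤ)
    {v : EuclideanSpace ℝ (Fin d)} (hv : v ∈ Metric.ball (latticePoint n) (1 / 4)) :
    bumpSum c v = c n := by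
  have h1 : ∀ m, m ≠ n → halfBumpSchwartz d (v - latticePoint m) = 0 := by
    intro m hm
    rw [halfBumpSchwartz_apply, (halfBump d).zero_of_le_dist, Complex.ofReal_zero]
    rw [dist_zero_right, ← dist_eq_norm]
    have h2 := dist_triangle (latticePoint m) v (latticePoint n)
    have h3 := one_le_dist_latticePoint hm
    rw [Metric.mem_ball] at hv
    rw [dist_comm v]
    change 1 / 2 ≤ _
    linarith
  have h2 : halfBumpSchwartz d (v - latticePoint n) = 1 := by
    rw [halfBumpSchwartz_apply, (halfBump d).one_of_mem_closedBall, Complex.ofReal_one]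
    rw [mem_closedBall_zero_iff, ← dist_eq_norm]
    exact (Metric.mem_ball.1 hv).le
  rw [bumpSum, Finsupp.sum_eq_single n]
  · rw [h2, one_smul]
  · intro m _ hm
    rw [h1 m hm, zero_smul]
  · simp

lemma tsum_enorm_rpow_le_lintegral_bumpSum (c : (Fin d → ℤ) →₀ X) (p : ℝ) :
    volume (Metric.ball (0 : EuclideanSpace ℝ (Fin d)) (1 / 4)) * ∑' n, ‖c n‖ₑ ^ p ≤
      ∫⁻ v, ‖bumpSum c v‖ₑ ^ p := by
  calc _ = ∑' n, ∫⁻ v in Metric.ball (latticePoint n) (1 / 4), ‖bumpSum c v‖ₑ ^ p := by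
        rw [← ENNReal.tsum_mul_left]
        congr 1; ext n
        rw [setLIntegral_congr_fun (g := fun _ => ‖c n‖ₑ ^ p) measurableSet_ball
          (fun v hv => by simp only [bumpSum_eq_of_mem_ball c n hv]), setLIntegral_const,
          mul_comm]
        congr 1
        rw [← Measure.addHaar_ball_center volume (latticePoint n)]
    _ = ∫⁻ v in ⋃ n, Metric.ball (latticePoint n) (1 / 4), ‖bumpSum c v‖ₑ ^ p := by
        rw [lintegral_iUnion (fun _ => measurableSet_ball)]
        intro m n hmn
        refine Metric.ball_disjoint_ball ?_
        have := one_le_dist_latticePoint hmn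
        linarith
    _ ≤ _ := setLIntegral_le_lintegral _ _

/-- Translation by a lattice point becomes multiplication by a character, so the sum of translates
turns into a product with the trigonometric polynomial. -/
lemma fourierInv_bumpSum [CompleteSpace X] (c : (Fin d → ℤ) →₀ X)
    (w : EuclideanSpace ℝ (Fin d)) :
    𝓕⁻ (bumpSum c) w =
      (𝓕⁻ (halfBumpSchwartz d : EuclideanSpace ℝ (Fin d) → ℂ)) w •
        trigPoly c (fun i => (w i : UnitAddCircle)) := by
  rw [Real.fourierInv_eq', Real.fourierInv_eq']
  simp only [bumpSum, trigPoly, Finsupp.sum, Finset.smul_sum]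
  have hint : Integrable fun v : EuclideanSpace ℝ (Fin d) =>
      Complex.exp (↑(2 * Real.pi * inner ℝ v w) * Complex.I) • halfBumpSchwartz d v := by
    refine ((halfBumpSchwartz d).integrable).mono ?_ ?_
    · have := (halfBumpSchwartz d).continuous
      exact Continuous.aestronglyMeasurable (by fun_prop)
    · refine Filter.Eventually.of_forall fun v => ?_
      rw [norm_smul, Complex.norm_exp_ofReal_mul_I, one_mul]
  have key : ∀ (n : Fin d → ℤ) (v : EuclideanSpace ℝ (Fin d)),
      Complex.exp (↑(2 * Real.pi * inner ℝ v w) * Complex.I) •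
        halfBumpSchwartz d (v - latticePoint n) • c n =
      (fun v => (Complex.exp (↑(2 * Real.pi * inner ℝ v w) * Complex.I) •
        halfBumpSchwartz d v)) (v - latticePoint n) •
        (Complex.exp (↑(2 * Real.pi * inner ℝ (latticePoint n) w) * Complex.I) • c n) := by
    intro n v
    beta_reduce
    rw [smul_smul, smul_smul, smul_eq_mul,
      mul_right_comm (Complex.exp _) _ (Complex.exp _), ← Complex.exp_add]
    congr 3
    rw [inner_sub_left]
    push_cast
    ring
  simp_rw [key]
  rw [integral_finsetSum]
  · refine Finset.sum_congr rfl fun n _ => ?_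
    rw [integral_smul_const, integral_sub_right_eq_self (fun v =>
      Complex.exp (↑(2 * Real.pi * inner ℝ v w) * Complex.I) • halfBumpSchwartz d v),
      mFourier_eq_exp]
  · intro n _
    exact (hint.comp_sub_right (latticePoint n)).smul_const _

lemma exists_enorm_fourierInv_halfBump_rpow_le (d : ℕ) {p : ℝ} (hp : 1 ≤ p) :
    ∃ C : ℝ≥0, ∀ w : EuclideanSpace ℝ (Fin d),
      ‖(𝓕⁻ (halfBumpSchwartz d : EuclideanSpace ℝ (Fin d) → ℂ)) w‖ₑ ^ p ≤
        C * ENNReal.ofReal ((1 + ‖WithLp.ofLp w‖) ^ (-((d : ℝ) + 1))) := by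
  set g := 𝓕⁻ (halfBumpSchwartz d) with hg
  obtain ⟨A, hA⟩ : ∃ A : ℝ, ∀ w, (1 + ‖w‖) ^ (d + 1) * ‖g w‖ ≤ A := by
    refine ⟨2 ^ (d + 1) * ((Finset.Iic (d + 1, 0)).sup
      fun m => SchwartzMap.seminorm ℂ m.1 m.2) g, fun w => ?_⟩
    have := SchwartzMap.one_add_le_sup_seminorm_apply (𝕜 := ℂ) (m := (d + 1, 0)) le_rfl le_rfl g w
    rwa [norm_iteratedFDeriv_zero] at this
  have hA0 : 0 ≤ A := le_trans (by positivity) (hA 0)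
  refine ⟨(A ^ p).toNNReal, fun w => ?_⟩
  have e : ‖(𝓕⁻ (halfBumpSchwartz d : EuclideanSpace ℝ (Fin d) → ℂ)) w‖ₑ = ‖g w‖ₑ := by
    rw [hg, SchwartzMap.fourierInv_coe]
  rw [e, ← ofReal_norm, ENNReal.ofReal_rpow_of_nonneg (norm_nonneg _) (by linarith),
    ENNReal.ofNNReal_toNNReal, ← ENNReal.ofReal_mul (by positivity)]
  apply ENNReal.ofReal_le_ofReal
  have hw : ‖WithLp.ofLp w‖ ≤ ‖w‖ := by
    rw [pi_norm_le_iff_of_nonneg (norm_nonneg _)]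
    exact fun i => PiLp.norm_apply_le w i
  set y := 1 + ‖WithLp.ofLp w‖ with hy
  have hy1 : 1 ≤ y := by linarith [norm_nonneg (WithLp.ofLp w)]
  have h1 : y ^ ((d : ℝ) + 1) * ‖g w‖ ≤ A := by
    refine le_trans ?_ (hA w)
    rw [show (d : ℝ) + 1 = ((d + 1 : ℕ) : ℝ) by push_cast; rfl, Real.rpow_natCast]
    gcongr
    linarith
  have h2 : ‖g w‖ ≤ A * y ^ (-((d : ℝ) + 1)) := by
    rw [Real.rpow_neg (by positivity), ← div_eq_mul_inv, le_div_iff₀ (by positivity)]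
    linarith
  calc ‖g w‖ ^ p ≤ (A * y ^ (-((d : ℝ) + 1))) ^ p := by gcongr
    _ = A ^ p * (y ^ (-((d : ℝ) + 1))) ^ p := Real.mul_rpow hA0 (by positivity)
    -- The base is at most 1 and p ≥ 1, so lowering the exponent to 1 only increases the value.
    _ ≤ A ^ p * (y ^ (-((d : ℝ) + 1))) ^ (1 : ℝ) := by
        refine mul_le_mul_of_nonneg_left ?_ (by positivity)
        refine Real.rpow_le_rpow_of_exponent_ge (by positivity) ?_ hp
        exact Real.rpow_le_one_of_one_le_of_nonpos hy1 (by
          have := d.cast_nonneg (α := ℝ); linarith)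
    _ = _ := by rw [Real.rpow_one]

lemma HasFourierType.exists_trigPoly_le [CompleteSpace X] {p : ℝ≥0∞} (hp : 1 < p) (hp' : p ≠ ∞)
    (hX : HasFourierType d p X) :
    ∃ C : ℝ≥0, ∀ c : (Fin d → ℤ) →₀ X,
      (∑' n, ‖c n‖ₑ ^ p.conjExponent.toReal) ^ (1 / p.conjExponent.toReal) ≤
        C * eLpNorm (trigPoly c) p (torusMeasure d) := by
  obtain ⟨A, hA⟩ := hX
  have hpr : 1 < p.toReal := by
    rw [← ENNReal.toReal_one]; exact (ENNReal.toReal_lt_toReal (by simp) hp').2 hp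
  obtain ⟨B, hB⟩ := exists_enorm_fourierInv_halfBump_rpow_le d hpr.le
  obtain ⟨K, hK⟩ := exists_lintegral_mul_periodic_le d
  have hq0 : p.conjExponent ≠ 0 := by
    simp [ENNReal.conjExponent]
  have hq1 : p.conjExponent ≠ ∞ := by
    simpa [ENNReal.conjExponent, tsub_eq_zero_iff_le] using hp
  set q := p.conjExponent
  set v := volume (Metric.ball (0 : EuclideanSpace ℝ (Fin d)) (1 / 4)) with hv
  have hv0 : v ≠ 0 := (Metric.measure_ball_pos volume _ (by norm_num)).ne'
  have hvt : v ≠ ∞ := measure_ball_lt_top.ne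
  have hqr : 0 < q.toReal := ENNReal.toReal_pos hq0 hq1
  have hfin : (v ^ (1 / q.toReal))⁻¹ * (A * (B * K : ℝ≥0∞) ^ (1 / p.toReal)) ≠ ∞ := by
    refine ENNReal.mul_ne_top (ENNReal.inv_ne_top.2 ?_) (ENNReal.mul_ne_top (by simp) ?_)
    · exact (ENNReal.rpow_pos (pos_iff_ne_zero.2 hv0) hvt).ne'
    · exact ENNReal.rpow_ne_top_of_nonneg (by positivity) (by finiteness)
  refine ⟨_, fun c => le_of_le_of_eq ?_ (congrArg (· * _) (ENNReal.coe_toNNReal hfin).symm)⟩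
  -- The Fourier type inequality is applied to the inverse transform, so that the bumps appear on
  -- the left, in the conjugate exponent.
  have hf := hA (𝓕⁻ (bumpSumSchwartz c))
  have e1 : 𝓕 ((𝓕⁻ (bumpSumSchwartz c) : 𝓢(EuclideanSpace ℝ (Fin d), X)) :
      EuclideanSpace ℝ (Fin d) → X) = bumpSum c := by
    rw [← SchwartzMap.fourier_coe, FourierTransform.fourier_fourierInv_eq]; rfl
  have e2 : ((𝓕⁻ (bumpSumSchwartz c) : 𝓢(EuclideanSpace ℝ (Fin d), X)) :
      EuclideanSpace ℝ (Fin d) → X) = 𝓕⁻ (bumpSum c) := by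
    rw [SchwartzMap.fourierInv_coe]; rfl
  rw [e1, e2, eLpNorm_eq_lintegral_rpow_enorm_toReal hq0 hq1,
    eLpNorm_eq_lintegral_rpow_enorm_toReal (by positivity) hp'] at hf
  have h1 := tsum_enorm_rpow_le_lintegral_bumpSum c q.toReal
  have h2 : ∫⁻ w, ‖𝓕⁻ (bumpSum c) w‖ₑ ^ p.toReal ≤
      B * (K * ∫⁻ x, ‖trigPoly c x‖ₑ ^ p.toReal ∂(torusMeasure d)) := by
    calc _ ≤ ∫⁻ w : EuclideanSpace ℝ (Fin d), B *
            (ENNReal.ofReal ((1 + ‖WithLp.ofLp w‖) ^ (-((d : ℝ) + 1))) *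
              ‖trigPoly c (fun i => (w i : UnitAddCircle))‖ₑ ^ p.toReal) := by
          refine lintegral_mono fun w => ?_
          rw [fourierInv_bumpSum, enorm_smul, ENNReal.mul_rpow_of_nonneg _ _ (by linarith),
            ← mul_assoc]
          gcongr
          exact hB w
      _ = B * ∫⁻ w : EuclideanSpace ℝ (Fin d),
            (ENNReal.ofReal ((1 + ‖WithLp.ofLp w‖) ^ (-((d : ℝ) + 1))) *
              ‖trigPoly c (fun i => (w i : UnitAddCircle))‖ₑ ^ p.toReal) :=
          lintegral_const_mul' _ _ (by simp)
      _ = B * ∫⁻ w : Fin d → ℝ,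
            (ENNReal.ofReal ((1 + ‖w‖) ^ (-((d : ℝ) + 1))) *
              ‖trigPoly c (fun i => (w i : UnitAddCircle))‖ₑ ^ p.toReal) := by
          congr 1
          exact (PiLp.volume_preserving_ofLp (Fin d)).lintegral_comp_emb
            (MeasurableEquiv.toLp 2 (Fin d → ℝ)).symm.measurableEmbedding
            (fun w : Fin d → ℝ => ENNReal.ofReal ((1 + ‖w‖) ^ (-((d : ℝ) + 1))) *
              ‖trigPoly c (fun i => (w i : UnitAddCircle))‖ₑ ^ p.toReal)
      _ ≤ _ := by gcongr; exact hK fun x => ‖trigPoly c x‖ₑ ^ p.toReal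
  have hvr0 : v ^ (1 / q.toReal) ≠ 0 := (ENNReal.rpow_pos (pos_iff_ne_zero.2 hv0) hvt).ne'
  have hvrt : v ^ (1 / q.toReal) ≠ ∞ := ENNReal.rpow_ne_top_of_nonneg (by positivity) hvt
  rw [eLpNorm_eq_lintegral_rpow_enorm_toReal (by positivity) hp', mul_assoc]
  set S := ∑' n, ‖c n‖ₑ ^ q.toReal
  set I := ∫⁻ x, ‖trigPoly c x‖ₑ ^ p.toReal ∂(torusMeasure d)
  calc S ^ (1 / q.toReal)
      = (v ^ (1 / q.toReal))⁻¹ * (v * S) ^ (1 / q.toReal) := by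
        rw [ENNReal.mul_rpow_of_nonneg _ _ (by positivity), ← mul_assoc,
          ENNReal.inv_mul_cancel hvr0 hvrt, one_mul]
    _ ≤ (v ^ (1 / q.toReal))⁻¹ * (A * (B * (K * I)) ^ (1 / p.toReal)) := by
        refine mul_le_mul' le_rfl (le_trans ?_ (hf.trans ?_))
        · exact ENNReal.rpow_le_rpow h1 (by positivity)
        · exact mul_le_mul' le_rfl (ENNReal.rpow_le_rpow h2 (by positivity))
    _ = _ := by
        rw [← mul_assoc (B : ℝ≥0∞), ENNReal.mul_rpow_of_nonneg _ _ (by positivity)]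
        ring

/-- By density of simple functions it is enough to treat 1_s · y; a scalar trigonometric polynomial
close to 1_s, multiplied by y, does this. -/
lemma exists_trigPoly_eLpNorm_sub_le {p : ℝ≥0∞} (hp : 1 ≤ p) (hp' : p ≠ ∞)
    {f : UnitAddTorus (Fin d) → X} (hf : MemLp f p (torusMeasure d)) {ε : ℝ≥0∞} (hε : ε ≠ 0) :
    ∃ c : (Fin d → ℤ) →₀ X, eLpNorm (f - trigPoly c) p (torusMeasure d) ≤ ε := by
  classical
  suffices h : ∃ g : UnitAddTorus (Fin d) → X, eLpNorm (f - g) p (torusMeasure d) ≤ ε ∧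
      ∃ c : (Fin d → ℤ) →₀ X, g = trigPoly c by
    obtain ⟨g, hg, c, rfl⟩ := h
    exact ⟨c, hg⟩
  refine hf.induction_dense hp' _ ?_ ?_ ?_ hε
  · intro y s hs hμs ε hε
    have : Fact (1 ≤ p) := ⟨hp⟩
    -- The minimum with 1 keeps δ finite when y = 0, where ε / ‖y‖ is ∞.
    obtain ⟨δ, hδ0, hδt, hδ⟩ : ∃ δ : ℝ≥0∞, δ ≠ 0 ∧ δ ≠ ∞ ∧ ‖y‖ₑ * δ ≤ ε := by
      refine ⟨min (ε / ‖y‖ₑ) 1, ?_, ?_, ?_⟩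
      · exact (lt_min (ENNReal.div_pos hε enorm_ne_top) one_pos).ne'
      · exact ((min_le_right _ _).trans_lt ENNReal.one_lt_top).ne
      · exact (mul_le_mul' le_rfl (min_le_left _ _)).trans ENNReal.mul_div_le
    have hs1 : MemLp (s.indicator fun _ => (1 : ℂ)) p (torusMeasure d) :=
      memLp_indicator_const p hs 1 (Or.inr hμs.ne)
    have hdense := span_mFourierLp_closure_eq_top (d := Fin d) hp'
    have hmem : hs1.toLp _ ∈ (Submodule.span ℂ
        (Set.range (mFourierLp (d := Fin d) p))).topologicalClosure := by
      rw [hdense]; trivial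
    obtain ⟨φ, hφ, hdist⟩ := EMetric.mem_closure_iff.1 hmem δ (pos_iff_ne_zero.2 hδ0)
    obtain ⟨a, rfl⟩ := Finsupp.mem_span_range_iff_exists_finsupp.1 hφ
    have haeq : ((a.sum fun n z => z • mFourierLp p n : Lp ℂ p (torusMeasure d)) :
        UnitAddTorus (Fin d) → ℂ) =ᵐ[torusMeasure d] trigPoly a := by
      have e : (a.sum fun n z => z • mFourierLp p n : Lp ℂ p (torusMeasure d)) =
          ContinuousMap.toLp (E := ℂ) p (torusMeasure d) ℂ (a.sum fun n z => z • mFourier n) := by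
        simp only [Finsupp.sum, map_sum, map_smul]
        rfl
      rw [e]
      refine (ContinuousMap.coeFn_toLp (torusMeasure d) _).trans
        (Filter.Eventually.of_forall fun x => ?_)
      simp [trigPoly, Finsupp.sum, mul_comm]
    refine ⟨_, ?_, a.mapRange (fun z => z • y) (by simp), rfl⟩
    have hpt : trigPoly (a.mapRange (fun z : ℂ => z • y) (by simp)) - s.indicator (fun _ => y) =
        fun x => (trigPoly a - s.indicator fun _ => (1 : ℂ)) x • y := by
      ext x
      have e1 : trigPoly (a.mapRange (fun z : ℂ => z • y) (by simp)) x = trigPoly a x • y := by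
        simp only [trigPoly]
        rw [Finsupp.sum_mapRange_index (by simp), Finsupp.sum, Finsupp.sum, Finset.sum_smul]
        simp [smul_smul]
      have e2 : s.indicator (fun _ => y) x = s.indicator (fun _ => (1 : ℂ)) x • y := by
        by_cases hx : x ∈ s <;> simp [hx]
      rw [Pi.sub_apply, Pi.sub_apply, e1, e2, sub_smul]
    rw [hpt]
    calc _ ≤ ‖y‖ₑ * eLpNorm (trigPoly a - s.indicator fun _ => (1 : ℂ)) p (torusMeasure d) := by
          refine eLpNorm_le_nnreal_smul_eLpNorm_of_ae_le_mul (c := ‖y‖₊)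
            (Filter.Eventually.of_forall fun x => ?_) p
          rw [nnnorm_smul, mul_comm]
      _ ≤ ‖y‖ₑ * δ := by
          refine mul_le_mul' le_rfl ?_
          have hd : edist (hs1.toLp _) (a.sum fun n z => z • mFourierLp p n :
            Lp ℂ p (torusMeasure d)) ≤ δ := hdist.le
          rw [Lp.edist_def] at hd
          refine le_trans (le_of_eq ?_) hd
          rw [← eLpNorm_neg, neg_sub]
          refine eLpNorm_congr_ae ?_
          filter_upwards [haeq, hs1.coeFn_toLp] with x h1 h2
          rw [Pi.sub_apply, Pi.sub_apply, h2, ← h1]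
      _ ≤ ε := hδ
  · rintro _ _ ⟨c, rfl⟩ ⟨c', rfl⟩
    exact ⟨c + c', (trigPoly_add c c').symm⟩
  · rintro _ ⟨c, rfl⟩
    exact (continuous_trigPoly c).aestronglyMeasurable

lemma norm_mFourier_apply_le (n : Fin d → ℤ) (x : UnitAddTorus (Fin d)) : ‖mFourier n x‖ ≤ 1 :=
  ((mFourier n).norm_coe_le_norm x).trans mFourier_norm.le

lemma enorm_mFourierCoeff_le (f : UnitAddTorus (Fin d) → X) (n : Fin d → ℤ) :
    ‖mFourierCoeff f n‖ₑ ≤ ∫⁻ x, ‖f x‖ₑ ∂(torusMeasure d) := by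
  rw [mFourierCoeff_eq]
  refine (enorm_integral_le_lintegral_enorm _).trans (lintegral_mono fun x => ?_)
  rw [enorm_smul]
  refine mul_le_of_le_one_left zero_le ?_
  rw [← ofReal_norm, ENNReal.ofReal_le_one]
  exact norm_mFourier_apply_le _ _

lemma integrable_mFourier_smul {f : UnitAddTorus (Fin d) → X}
    (hf : Integrable f (torusMeasure d)) (n : Fin d → ℤ) :
    Integrable (fun x => mFourier n x • f x) (torusMeasure d) := by
  exact hf.bdd_smul 1 (mFourier n).continuous.aestronglyMeasurable
    (Filter.Eventually.of_forall fun x => norm_mFourier_apply_le n x)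

lemma mFourierCoeff_add {f g : UnitAddTorus (Fin d) → X} (hf : Integrable f (torusMeasure d))
    (hg : Integrable g (torusMeasure d)) (n : Fin d → ℤ) :
    mFourierCoeff (f + g) n = mFourierCoeff f n + mFourierCoeff g n := by
  simp only [mFourierCoeff_eq, Pi.add_apply, smul_add]
  exact integral_add (integrable_mFourier_smul hf _) (integrable_mFourier_smul hg _)

/-- Fourier type `p` on `ℝ^d` implies the Hausdorff--Young inequality on the torus. -/
lemma HasFourierType.exists_mFourierCoeff_le [CompleteSpace X] {p : ℝ≥0∞} (hp : 1 < p)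
    (hp' : p ≠ ∞) (hX : HasFourierType d p X) :
    ∃ C : ℝ≥0, ∀ f : UnitAddTorus (Fin d) → X, MemLp f p (torusMeasure d) →
      (∑' n, ‖mFourierCoeff f n‖ₑ ^ p.conjExponent.toReal) ^ (1 / p.conjExponent.toReal) ≤
        C * eLpNorm f p (torusMeasure d) := by
  obtain ⟨C, hC⟩ := hX.exists_trigPoly_le hp hp'
  refine ⟨C, fun f hf => ?_⟩
  have hq1 : p.conjExponent ≠ ∞ := by
    simpa [ENNReal.conjExponent, tsub_eq_zero_iff_le] using hp
  have hqr : 1 ≤ p.conjExponent.toReal := by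
    rw [← ENNReal.toReal_one]
    exact ENNReal.toReal_mono hq1 (by simp [ENNReal.conjExponent])
  set q := p.conjExponent.toReal
  have hq0 : 0 < q := by linarith
  rw [one_div, ENNReal.rpow_inv_le_iff hq0, ENNReal.tsum_eq_iSup_sum]
  refine iSup_le fun F => ?_
  rw [← ENNReal.rpow_inv_le_iff hq0, ← one_div]
  -- The coefficients of f - P are controlled only uniformly, by η. On the finite set F such an
  -- error has ℓ^q norm at most N η, so η is chosen after F.
  set N : ℝ≥0 := (F.card : ℝ≥0) ^ (1 / q)
  refine ENNReal.le_of_forall_pos_le_add fun ε hε _ => ?_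
  set η : ℝ≥0 := ε / (C + N + 1)
  have hη : η ≠ 0 := (div_pos hε (by positivity)).ne'
  have hηε : (C : ℝ≥0∞) * η + N * η ≤ ε := by
    rw [← add_mul]
    norm_cast
    calc (C + N) * η ≤ (C + N + 1) * η := mul_le_mul' le_self_add le_rfl
      _ = ε := mul_div_cancel₀ _ (by positivity)
  obtain ⟨c, hc⟩ := exists_trigPoly_eLpNorm_sub_le hp.le hp' hf (ε := η) (by simpa using hη)
  have hcLp : MemLp (trigPoly c) p (torusMeasure d) :=
    (continuous_trigPoly c).memLp_of_hasCompactSupport (HasCompactSupport.of_compactSpace _)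
  have hP : eLpNorm (trigPoly c) p (torusMeasure d) ≤ eLpNorm f p (torusMeasure d) + η := by
    have e : trigPoly c = f - (f - trigPoly c) := by simp
    rw [e]
    exact (eLpNorm_sub_le hf.1 (hf.1.sub hcLp.1) hp.le).trans (by gcongr)
  have hcoeff : ∀ n, ‖mFourierCoeff f n‖ₑ ≤ ‖c n‖ₑ + η := by
    intro n
    have e : f = trigPoly c + (f - trigPoly c) := by simp
    have hsub := hf.sub hcLp
    conv_lhs => rw [e, mFourierCoeff_add (hcLp.integrable hp.le) (hsub.integrable hp.le),
      mFourierCoeff_trigPoly]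
    refine (enorm_add_le _ _).trans ?_
    gcongr
    calc _ ≤ ∫⁻ x, ‖(f - trigPoly c) x‖ₑ ∂(torusMeasure d) := enorm_mFourierCoeff_le _ _
      _ = eLpNorm (f - trigPoly c) 1 (torusMeasure d) := eLpNorm_one_eq_lintegral_enorm.symm
      _ ≤ eLpNorm (f - trigPoly c) p (torusMeasure d) :=
          eLpNorm_le_eLpNorm_of_exponent_le hp.le hsub.1
      _ ≤ η := hc
  calc (∑ n ∈ F, ‖mFourierCoeff f n‖ₑ ^ q) ^ (1 / q)
      ≤ (∑ n ∈ F, (‖c n‖ₑ + η) ^ q) ^ (1 / q) := by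
        gcongr with n
        exact hcoeff n
    _ ≤ (∑ n ∈ F, ‖c n‖ₑ ^ q) ^ (1 / q) + (∑ n ∈ F, (η : ℝ≥0∞) ^ q) ^ (1 / q) :=
        ENNReal.Lp_add_le _ _ _ hqr
    _ ≤ C * (eLpNorm f p (torusMeasure d) + η) + N * η := by
        refine add_le_add ?_ (le_of_eq ?_)
        · refine le_trans (ENNReal.rpow_le_rpow (ENNReal.sum_le_tsum F) (by positivity)) ?_
          exact (hC c).trans (by gcongr)
        · rw [Finset.sum_const, nsmul_eq_mul, ENNReal.mul_rpow_of_nonneg _ _ (by positivity),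
            ← ENNReal.rpow_mul, mul_one_div_cancel hq0.ne', ENNReal.rpow_one,
            ENNReal.coe_rpow_of_nonneg _ (by positivity)]
          simp
    _ ≤ _ := by
        rw [mul_add, add_assoc]
        gcongr

end Transference

/-! ### Dyadic levels of the rearrangement and the splitting of f -/

section Rearrangement

variable {S X : Type*} [MeasurableSpace S] [NormedAddCommGroup X] {μ : Measure S}

lemma rearrangement_anti (μ : Measure S) (f : S → X) : Antitone (rearrangement μ f) :=
  fun _ _ h => sInf_le_sInf fun _ hl => le_trans hl h

/-- The infimum defining the rearrangement is attained, by continuity of μ along increasing unions.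
-/
lemma measure_rearrangement_lt_le (μ : Measure S) (f : S → X) (t : ℝ≥0∞) :
    μ {s | rearrangement μ f t < ‖f s‖ₑ} ≤ t := by
  rcases eq_or_ne (rearrangement μ f t) ∞ with h | h
  · simp [h]
  obtain ⟨u, hu, hlt, hlim⟩ := exists_seq_strictAnti_tendsto' (lt_top_iff_ne_top.2 h)
  have hU : {s | rearrangement μ f t < ‖f s‖ₑ} = ⋃ n, {s | u n < ‖f s‖ₑ} := by
    ext s
    simp only [Set.mem_ofPred_eq, Set.mem_iUnion]
    constructor
    · intro hs
      exact (hlim.eventually_lt_const hs).exists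
    · rintro ⟨n, hn⟩
      exact (hlt n).1.trans hn
  rw [hU, Monotone.measure_iUnion]
  · refine iSup_le fun n => ?_
    obtain ⟨l, hl, hln⟩ := sInf_lt_iff.1 (hlt n).1
    exact (measure_mono fun s hs => hln.trans hs).trans hl
  · intro m n hmn s hs
    exact lt_of_le_of_lt (hu.antitone hmn) hs

lemma rearrangement_one [IsProbabilityMeasure μ] (f : S → X) : rearrangement μ f 1 = 0 :=
  le_antisymm (sInf_le prob_le_one) zero_le

/-- The values of the rearrangement at the points `2^{-j}`. -/
noncomputable def dyadicRearrangement (μ : Measure S) (f : S → X) (j : ℕ) : ℝ≥0∞ :=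
  rearrangement μ f (2⁻¹ ^ j)

lemma dyadicRearrangement_mono (μ : Measure S) (f : S → X) :
    Monotone (dyadicRearrangement μ f) := fun _ _ h =>
  rearrangement_anti μ f (pow_le_pow_of_le_one zero_le (by simp) h)

lemma nullMeasurableSet_dyadicRearrangement_lt {f : S → X} (hf : AEStronglyMeasurable f μ)
    (j : ℕ) : NullMeasurableSet {s | dyadicRearrangement μ f j < ‖f s‖ₑ} μ :=
  nullMeasurableSet_lt aemeasurable_const hf.enorm

/-- The part of `f` above the level `f^*(2^{-j})`. -/
noncomputable def upperPart (μ : Measure S) (f : S → X) (j : ℕ) : S → X :=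
  {s | dyadicRearrangement μ f j < ‖f s‖ₑ}.indicator f

/-- The part of `f` below the level `f^*(2^{-j})`. -/
noncomputable def lowerPart (μ : Measure S) (f : S → X) (j : ℕ) : S → X :=
  {s | dyadicRearrangement μ f j < ‖f s‖ₑ}ᶜ.indicator f

lemma upperPart_add_lowerPart (μ : Measure S) (f : S → X) (j : ℕ) :
    upperPart μ f j + lowerPart μ f j = f :=
  Set.indicator_self_add_compl _ _

lemma ae_exists_enorm_le_dyadicRearrangement (μ : Measure S) (f : S → X) :
    ∀ᵐ s ∂μ, ∃ i, ‖f s‖ₑ ≤ dyadicRearrangement μ f i := by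
  rw [ae_iff]
  refine le_antisymm (ge_of_tendsto' (ENNReal.tendsto_pow_atTop_nhds_zero_of_lt_one
    (show (2⁻¹ : ℝ≥0∞) < 1 by simp)) fun i => ?_) zero_le
  refine (measure_mono fun s hs => ?_).trans (measure_rearrangement_lt_le μ f (2⁻¹ ^ i))
  simp only [not_exists, not_le, Set.mem_ofPred_eq] at hs ⊢
  exact hs i

lemma exists_level {a : ℕ → ℝ≥0∞} (ha : Monotone a) {y : ℝ≥0∞} {j i : ℕ} (hj : a j < y)
    (hi : y ≤ a i) : ∃ k, j + k + 1 ≤ i ∧ a (j + k) < y ∧ y ≤ a (j + k + 1) := by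
  classical
  have hex : ∃ i, y ≤ a i := ⟨i, hi⟩
  set n := Nat.find hex
  have hn : y ≤ a n := Nat.find_spec hex
  have hjn : j < n := by
    by_contra h
    exact absurd (hn.trans (ha (not_lt.1 h))) (not_le.2 hj)
  obtain ⟨k, hk⟩ := Nat.exists_eq_add_of_lt hjn
  refine ⟨k, ?_, ?_, ?_⟩
  · rw [← hk]; exact Nat.find_min' hex hi
  · exact not_le.1 (Nat.find_min hex (show j + k < n by omega))
  · rw [← hk]; exact hn

/-- Almost every point where the upper part is nonzero lies in a layer f*(2^{-i}) < ‖f‖ ≤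
f*(2^{-(i+1)}) with i ≥ j, and this layer has measure at most 2^{-i}. -/
lemma lintegral_enorm_upperPart_le {f : S → X} (hf : AEStronglyMeasurable f μ) (j : ℕ) :
    ∫⁻ s, ‖upperPart μ f j s‖ₑ ∂μ ≤
      ∑' k, 2⁻¹ ^ (j + k) * dyadicRearrangement μ f (j + k + 1) := by
  set a := dyadicRearrangement μ f with ha
  calc _ ≤ ∫⁻ s, ∑' k, {s | a (j + k) < ‖f s‖ₑ}.indicator (fun _ => a (j + k + 1)) s ∂μ := by
        refine lintegral_mono_ae ?_
        filter_upwards [ae_exists_enorm_le_dyadicRearrangement μ f] with s hs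
        by_cases hjs : a j < ‖f s‖ₑ
        · obtain ⟨i, hi⟩ := hs
          obtain ⟨k, -, h1, h2⟩ := exists_level (dyadicRearrangement_mono μ f) hjs hi
          refine le_trans ?_ (ENNReal.le_tsum k)
          rw [upperPart, Set.indicator_of_mem (by exact hjs), Set.indicator_of_mem (by exact h1)]
          exact h2
        · rw [upperPart, Set.indicator_of_notMem (by exact hjs)]
          simp
    _ = ∑' k, a (j + k + 1) * μ {s | a (j + k) < ‖f s‖ₑ} := by
        rw [lintegral_tsum fun k => (aemeasurable_const.indicator₀
          (nullMeasurableSet_dyadicRearrangement_lt hf (j + k)))]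
        congr 1; ext k
        exact lintegral_indicator_const₀ (nullMeasurableSet_dyadicRearrangement_lt hf (j + k)) _
    _ ≤ _ := by
        refine ENNReal.tsum_le_tsum fun k => ?_
        rw [mul_comm]
        exact mul_le_mul' (measure_rearrangement_lt_le _ _ _) le_rfl

lemma lintegral_enorm_lowerPart_rpow_le [IsProbabilityMeasure μ] {f : S → X}
    (hf : AEStronglyMeasurable f μ) (j : ℕ) {p : ℝ} (hp : 0 < p) :
    ∫⁻ s, ‖lowerPart μ f j s‖ₑ ^ p ∂μ ≤
      ∑ i ∈ Finset.range j, 2⁻¹ ^ i * dyadicRearrangement μ f (i + 1) ^ p := by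
  set a := dyadicRearrangement μ f with ha
  -- Total mass 1 gives f*(1) = 0, so the layers from index 0 on cover all points where f is nonzero
  -- and at most a j.
  have ha0 : a 0 = 0 := by
    rw [ha, dyadicRearrangement, pow_zero, rearrangement_one]
  calc _ ≤ ∫⁻ s, ∑ i ∈ Finset.range j,
          {s | a i < ‖f s‖ₑ}.indicator (fun _ => a (i + 1) ^ p) s ∂μ := by
        refine lintegral_mono fun s => ?_
        by_cases hjs : a j < ‖f s‖ₑ
        · rw [lowerPart, Set.indicator_of_notMem (by simpa using hjs)]
          simp [hp]
        · rw [lowerPart, Set.indicator_of_mem (by exact hjs)]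
          rcases eq_or_ne ‖f s‖ₑ 0 with h0 | h0
          · simp [h0, hp]
          · obtain ⟨k, hk, h1, h2⟩ := exists_level (dyadicRearrangement_mono μ f)
              (show a 0 < ‖f s‖ₑ by rw [ha0]; exact pos_iff_ne_zero.2 h0) (not_lt.1 hjs)
            rw [zero_add] at hk h1 h2
            refine le_trans ?_ (Finset.single_le_sum (fun _ _ => zero_le)
              (Finset.mem_range.2 hk))
            rw [Set.indicator_of_mem (by exact h1)]
            gcongr
    _ = ∑ i ∈ Finset.range j, a (i + 1) ^ p * μ {s | a i < ‖f s‖ₑ} := by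
        rw [lintegral_finsetSum' _ fun k _ => (aemeasurable_const.indicator₀
          (nullMeasurableSet_dyadicRearrangement_lt hf k))]
        refine Finset.sum_congr rfl fun k _ => ?_
        exact lintegral_indicator_const₀ (nullMeasurableSet_dyadicRearrangement_lt hf k) _
    _ ≤ _ := by
        refine Finset.sum_le_sum fun k _ => ?_
        rw [mul_comm]
        exact mul_le_mul' (measure_rearrangement_lt_le _ _ _) le_rfl

end Rearrangement

/-! ### Rearrangements of families and their dyadic values -/

section SeqRearrangement

variable {I X : Type*} [NormedAddCommGroup X]

lemma seqRearrangement_anti (x : I → X) : Antitone (seqRearrangement x) :=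
  fun _ _ h => sInf_le_sInf fun l (hl : Set.encard {n | l < ‖x n‖ₑ} < _) =>
    show Set.encard {n | l < ‖x n‖ₑ} < _ from
      lt_of_lt_of_le hl (add_le_add (by exact_mod_cast h) le_rfl)

lemma seqRearrangement_le_add {x z : I → X} {A : ℝ≥0∞} (h : ∀ n, ‖x n‖ₑ ≤ A + ‖z n‖ₑ) (k : ℕ) :
    seqRearrangement x k ≤ A + seqRearrangement z k := by
  rw [seqRearrangement, seqRearrangement, ENNReal.add_sInf]
  refine le_iInf₂ fun l hl => sInf_le ?_
  refine lt_of_le_of_lt (Set.encard_le_encard fun n (hn : _ < ‖x n‖ₑ) => ?_) hl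
  by_contra hl'
  exact absurd ((h n).trans (by gcongr; simpa using hl')) (not_le.2 hn)

/-- The values `x^*_{2^i}` of the rearrangement. -/
noncomputable def dyadicSeqRearrangement (x : I → X) (i : ℕ) : ℝ≥0∞ :=
  seqRearrangement x (2 ^ i - 1)

lemma two_pow_le_encard_of_lt_dyadicSeqRearrangement {x : I → X} {i : ℕ} {l : ℝ≥0∞}
    (h : l < dyadicSeqRearrangement x i) : (2 ^ i : ℕ) ≤ Set.encard {n | l < ‖x n‖ₑ} := by
  by_contra h'
  refine absurd (sInf_le ?_) (not_le.2 h)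
  have : ((2 ^ i - 1 : ℕ) : ℕ∞) + 1 = (2 ^ i : ℕ) := by
    norm_cast
    exact Nat.sub_add_cancel Nat.one_le_two_pow
  rw [Set.mem_ofPred_eq, this]
  exact not_le.1 h'

lemma seqRearrangement_le_tsum_rpow (x : I → X) {r : ℝ} (hr : 0 < r) (k : ℕ) :
    seqRearrangement x k ≤ (∑' n, ‖x n‖ₑ ^ r) ^ r⁻¹ := by
  refine sInf_le ?_
  have : {n | (∑' n, ‖x n‖ₑ ^ r) ^ r⁻¹ < ‖x n‖ₑ} = ∅ := by
    refine Set.eq_empty_of_forall_notMem fun n (hn : _ < ‖x n‖ₑ) => absurd ?_ (not_le.2 hn)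
    rw [ENNReal.le_rpow_inv_iff hr]
    exact ENNReal.le_tsum n
  rw [Set.mem_ofPred_eq, this]
  simp

lemma tsum_two_pow_indicator_le (M : ℕ∞) :
    ∑' i : ℕ, (if ((2 ^ i : ℕ) : ℕ∞) ≤ M then (2 : ℝ≥0∞) ^ i else 0) ≤ 2 * (M : ℝ≥0∞) := by
  induction M using ENat.recTopCoe with
  | top => simp
  | coe M =>
    rcases Nat.eq_zero_or_pos M with rfl | hM
    · simp
    rw [tsum_eq_sum (s := Finset.range (Nat.log 2 M + 1))]
    · calc _ ≤ ∑ i ∈ Finset.range (Nat.log 2 M + 1), (2 : ℝ≥0∞) ^ i :=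
            Finset.sum_le_sum fun i _ => by split_ifs <;> simp
        _ ≤ _ := by
            have h1 : ∑ i ∈ Finset.range (Nat.log 2 M + 1), 2 ^ i ≤ 2 * M := by
              have h2 := Nat.geomSum_eq (le_refl 2) (Nat.log 2 M + 1)
              have h3 := Nat.pow_log_le_self 2 hM.ne'
              rw [h2, pow_succ]
              omega
            rw [ENat.toENNReal_coe]
            exact_mod_cast h1
    · intro i hi
      rw [if_neg]
      simp only [Finset.mem_range, not_lt] at hi
      have := Nat.lt_pow_of_log_lt (b := 2) (by norm_num) (show Nat.log 2 M < i by omega)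
      exact_mod_cast not_le.2 this

/-- Layer-cake on both sides. If M indices satisfy ‖x n‖ > t, then x*_{2^i} > t forces 2^i ≤ M, and
the sum of such 2^i is at most 2M. -/
lemma tsum_two_pow_mul_dyadicSeqRearrangement_rpow_le (x : I → X) {r : ℝ} (hr : 0 < r) :
    ∑' i, (2 : ℝ≥0∞) ^ i * dyadicSeqRearrangement x i ^ r ≤ 2 * ∑' n, ‖x n‖ₑ ^ r := by
  rcases eq_or_ne (∑' n, ‖x n‖ₑ ^ r) ∞ with htop | htop
  · simp [htop]
  have hy : ∀ i, dyadicSeqRearrangement x i ≠ ∞ := fun i =>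
    ((seqRearrangement_le_tsum_rpow x hr _).trans_lt
      (ENNReal.rpow_lt_top_of_nonneg (by positivity) htop)).ne
  let : MeasurableSpace I := ⊤
  set y : ℕ → ℝ := fun i => (dyadicSeqRearrangement x i).toReal with hy_def
  -- Giving the point i the mass 2^i turns the dyadic sum into an integral, to which the layer-cake
  -- formula applies.
  set ν : Measure ℕ := Measure.sum fun i => (2 : ℝ≥0∞) ^ i • Measure.dirac i with hν
  have h1 : ∑' i, (2 : ℝ≥0∞) ^ i * dyadicSeqRearrangement x i ^ r =
      ∫⁻ i, ENNReal.ofReal (y i ^ r) ∂ν := by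
    rw [hν, lintegral_sum_measure]
    congr 1; ext i
    rw [lintegral_smul_measure, lintegral_dirac, smul_eq_mul,
      ← ENNReal.ofReal_rpow_of_nonneg ENNReal.toReal_nonneg hr.le, ENNReal.ofReal_toReal (hy i)]
  have h2 : ∑' n, ‖x n‖ₑ ^ r = ∫⁻ n, ENNReal.ofReal (‖x n‖ ^ r) ∂Measure.count := by
    rw [lintegral_count]
    congr 1; ext n
    rw [← ENNReal.ofReal_rpow_of_nonneg (norm_nonneg _) hr.le, ofReal_norm]
  rw [h1, h2, lintegral_rpow_eq_lintegral_meas_lt_mul ν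
      (Filter.Eventually.of_forall fun i => ENNReal.toReal_nonneg)
      (measurable_from_top).aemeasurable hr,
    lintegral_rpow_eq_lintegral_meas_lt_mul _
      (Filter.Eventually.of_forall fun i => norm_nonneg _)
      (measurable_from_top).aemeasurable hr, mul_left_comm,
    ← lintegral_const_mul' 2 _ (by simp)]
  refine mul_le_mul' le_rfl (setLIntegral_mono' measurableSet_Ioi fun t (ht : 0 < t) => ?_)
  rw [← mul_assoc]
  refine mul_le_mul' ?_ le_rfl
  have h3 : {n | t < ‖x n‖} = {n | ENNReal.ofReal t < ‖x n‖ₑ} := by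
    ext n
    rw [Set.mem_ofPred_eq, Set.mem_ofPred_eq, ← ofReal_norm,
      ENNReal.ofReal_lt_ofReal_iff_of_nonneg (le_of_lt ht)]
  rw [Measure.count_apply MeasurableSpace.measurableSet_top, h3]
  refine le_trans ?_ (tsum_two_pow_indicator_le _)
  rw [hν, Measure.sum_apply _ (by measurability)]
  refine ENNReal.tsum_le_tsum fun i => ?_
  rw [Measure.smul_apply, Measure.dirac_apply, smul_eq_mul]
  by_cases hti : t < y i
  · rw [if_pos]
    · exact mul_le_of_le_one_right zero_le (Set.indicator_le_self' (by simp) _)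
    · apply two_pow_le_encard_of_lt_dyadicSeqRearrangement
      rwa [ENNReal.ofReal_lt_iff_lt_toReal (le_of_lt ht) (hy i)]
  · rw [Set.indicator_of_notMem (by exact hti)]
    simp

end SeqRearrangement

/-! ### Comparison of the Lorentz–Zygmund norms with dyadic sums -/

section DyadicNorms

lemma rpow_le_two_rpow_abs_mul_rpow {x y : ℝ} (hx : 0 < x) (hy : 0 < y) (h1 : x ≤ 2 * y)
    (h2 : y ≤ 2 * x) (c : ℝ) : x ^ c ≤ 2 ^ |c| * y ^ c := by
  rcases le_total 0 c with h | h
  · rw [abs_of_nonneg h, ← Real.mul_rpow (by norm_num) hy.le]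
    exact Real.rpow_le_rpow hx.le h1 h
  · have h3 := Real.rpow_le_rpow_of_nonpos hy h2 h
    rw [Real.mul_rpow (by norm_num) hx.le] at h3
    rw [abs_of_nonpos h, Real.rpow_neg (by norm_num), le_inv_mul_iff₀ (by positivity)]
    exact h3

lemma two_rpow_eq_ofReal (x : ℝ) : (2 : ℝ≥0∞) ^ x = ENNReal.ofReal (2 ^ x) := by
  rw [← ENNReal.ofReal_rpow_of_pos (by norm_num)]
  simp

/-- For `2^j ≤ s < 2^(j+1)`, the quantity `1 + log s` is comparable with `j + 1`. -/
lemma one_add_log_comparable {s : ℝ} {j : ℕ} (h1 : (2 : ℝ) ^ j ≤ s) (h2 : s ≤ 2 ^ (j + 1)) :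
    (j : ℝ) + 1 ≤ 2 * (1 + Real.log s) ∧ 1 + Real.log s ≤ 2 * ((j : ℝ) + 1) ∧ 0 ≤ Real.log s := by
  have hs : 0 < s := lt_of_lt_of_le (by positivity) h1
  have l1 := Real.log_le_log (by positivity) h1
  have l2 := Real.log_le_log hs h2
  rw [Real.log_pow] at l1 l2
  push_cast at l2
  have g1 := Real.log_two_gt_d9
  have g2 := Real.log_two_lt_d9
  have hj := j.cast_nonneg (α := ℝ)
  have p1 : (j : ℝ) * (1 / 2) ≤ j * Real.log 2 := by gcongr; linarith
  have p2 : ((j : ℝ) + 1) * Real.log 2 ≤ (j + 1) * 1 := by gcongr; linarith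
  refine ⟨?_, ?_, ?_⟩ <;> linarith

lemma exists_natWeight_mul_le_lzWeight (p : ℝ≥0∞) (c : ℝ) :
    ∃ C : ℝ≥0, ∀ (j : ℕ) (t : ℝ), 2⁻¹ ^ (j + 1) ≤ t → t ≤ 2⁻¹ ^ j →
      natWeight c j * 2 ^ (-((1 / p).toReal * j)) ≤ C * lzWeight p c t := by
  set θ := (1 / p).toReal with hθ
  have hθ0 : 0 ≤ θ := ENNReal.toReal_nonneg
  refine ⟨(2 ^ |c| * 2 ^ θ : ℝ).toNNReal, fun j t h1 h2 => ?_⟩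
  have ht : 0 < t := lt_of_lt_of_le (by positivity) h1
  rw [natWeight_eq_ofReal, two_rpow_eq_ofReal, lzWeight, ENNReal.ofNNReal_toNNReal,
    ← ENNReal.ofReal_mul (by positivity), ← ENNReal.ofReal_mul (by positivity)]
  apply ENNReal.ofReal_le_ofReal
  have hs1 : (2 : ℝ) ^ j ≤ t⁻¹ := by
    rw [le_inv_comm₀ (by positivity) ht, ← inv_pow]; exact h2
  have hs2 : t⁻¹ ≤ (2 : ℝ) ^ (j + 1) := by
    rw [inv_le_comm₀ ht (by positivity), ← inv_pow]; exact h1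
  obtain ⟨l1, l2, l3⟩ := one_add_log_comparable hs1 hs2
  have labs : |Real.log t| = Real.log t⁻¹ := by
    rw [Real.log_inv] at l3 ⊢
    exact abs_of_nonpos (by linarith)
  rw [labs, ← hθ]
  have a1 := rpow_le_two_rpow_abs_mul_rpow (by positivity) (by linarith) l1 l2 c
  have a2 : (2 : ℝ) ^ (-(θ * j)) ≤ 2 ^ θ * t ^ θ := by
    rw [← Real.mul_rpow (by norm_num) ht.le]
    have e : (2 : ℝ) ^ (-(θ * j)) = (2⁻¹ ^ j) ^ θ := by
      rw [← Real.rpow_natCast, ← Real.rpow_mul (by norm_num), Real.inv_rpow (by norm_num),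
        ← Real.rpow_neg (by norm_num)]
      congr 1; ring
    rw [e]
    refine Real.rpow_le_rpow (by positivity) ?_ hθ0
    rw [pow_succ] at h1
    linarith
  calc _ ≤ (2 ^ |c| * (1 + Real.log t⁻¹) ^ c) * (2 ^ θ * t ^ θ) := by gcongr
    _ = _ := by ring

lemma exists_lzWeight_le_natWeight_mul (p : ℝ≥0∞) (c : ℝ) :
    ∃ C : ℝ≥0, ∀ (i : ℕ) (s : ℝ), 2 ^ i ≤ s → s ≤ 2 ^ (i + 1) →
      lzWeight p c s ≤ C * (natWeight c i * 2 ^ ((1 / p).toReal * i)) := by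
  set θ := (1 / p).toReal with hθ
  have hθ0 : 0 ≤ θ := ENNReal.toReal_nonneg
  refine ⟨(2 ^ |c| * 2 ^ θ : ℝ).toNNReal, fun i s h1 h2 => ?_⟩
  have hs : 0 < s := lt_of_lt_of_le (by positivity) h1
  rw [natWeight_eq_ofReal, two_rpow_eq_ofReal, lzWeight, ENNReal.ofNNReal_toNNReal,
    ← ENNReal.ofReal_mul (by positivity), ← ENNReal.ofReal_mul (by positivity)]
  apply ENNReal.ofReal_le_ofReal
  obtain ⟨l1, l2, l3⟩ := one_add_log_comparable h1 h2
  rw [abs_of_nonneg l3, ← hθ]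
  have a1 := rpow_le_two_rpow_abs_mul_rpow (by linarith) (by positivity) l2 l1 c
  have a2 : s ^ θ ≤ 2 ^ θ * 2 ^ (θ * i) := by
    have e : (2 : ℝ) ^ θ * 2 ^ (θ * i) = (2 ^ (i + 1)) ^ θ := by
      rw [← Real.rpow_natCast, ← Real.rpow_mul (by norm_num), ← Real.rpow_add (by norm_num)]
      congr 1; push_cast; ring
    rw [e]
    exact Real.rpow_le_rpow hs.le h2 hθ0
  calc _ ≤ (2 ^ θ * 2 ^ (θ * i)) * (2 ^ |c| * ((i : ℝ) + 1) ^ c) := by gcongr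
    _ = _ := by ring

variable {S X : Type*} [MeasurableSpace S] [NormedAddCommGroup X]

lemma setOf_pos_ofReal_lt_univ (μ : Measure S) [IsProbabilityMeasure μ] :
    {t : ℝ | 0 < t ∧ ENNReal.ofReal t < μ Set.univ} = Set.Ioo 0 1 := by
  ext t
  simp [ENNReal.ofReal_lt_one]

lemma dyadicRearrangement_le (μ : Measure S) (f : S → X) {j : ℕ} {t : ℝ} (ht : t ≤ 2⁻¹ ^ j) :
    dyadicRearrangement μ f j ≤ rearrangement μ f (ENNReal.ofReal t) := by
  refine rearrangement_anti μ f ((ENNReal.ofReal_le_ofReal ht).trans (le_of_eq ?_))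
  rw [ENNReal.ofReal_pow (by positivity), ENNReal.ofReal_inv_of_pos (by norm_num)]
  simp

lemma exists_dyadic_le_lzNorm_top (p : ℝ≥0∞) (c : ℝ) :
    ∃ C : ℝ≥0, ∀ (μ : Measure S) [IsProbabilityMeasure μ] (f : S → X) (j : ℕ),
      natWeight c j * (2 ^ (-((1 / p).toReal * j)) * dyadicRearrangement μ f j) ≤
        C * lzNorm p ∞ c μ f := by
  obtain ⟨C, hC⟩ := exists_natWeight_mul_le_lzWeight p c
  refine ⟨C, fun μ _ f j => ?_⟩
  rw [lzNorm, if_pos rfl, setOf_pos_ofReal_lt_univ]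
  have h0 : (0 : ℝ) < 2⁻¹ ^ (j + 1) := by positivity
  have h1 : (2⁻¹ : ℝ) ^ (j + 1) < 1 := pow_lt_one₀ (by norm_num) (by norm_num) (by simp)
  have h2 : (2⁻¹ : ℝ) ^ (j + 1) ≤ 2⁻¹ ^ j :=
    pow_le_pow_of_le_one (by norm_num) (by norm_num) (by simp)
  rw [← mul_assoc]
  -- The evaluation point is 2^{-(j+1)} and not 2^{-j}, since for j = 0 the latter is 1 and lies
  -- outside the range of the supremum.
  calc _ ≤ (C * lzWeight p c (2⁻¹ ^ (j + 1))) *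
          rearrangement μ f (ENNReal.ofReal (2⁻¹ ^ (j + 1))) :=
        mul_le_mul' (hC j _ le_rfl h2) (dyadicRearrangement_le μ f h2)
    _ ≤ _ := by
        rw [mul_assoc]
        refine mul_le_mul' le_rfl ?_
        exact le_iSup₂ (f := fun (t : ℝ) (_ : t ∈ Set.Ioo (0 : ℝ) 1) =>
          lzWeight p c t * rearrangement μ f (ENNReal.ofReal t)) _ ⟨h0, h1⟩

lemma exists_tsum_dyadic_le_lzNorm (p : ℝ≥0∞) {q : ℝ≥0∞} (hq : 1 ≤ q) (hq' : q ≠ ∞) (c : ℝ) :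
    ∃ C : ℝ≥0, ∀ (μ : Measure S) [IsProbabilityMeasure μ] (f : S → X),
      ∑' j, (natWeight c j * (2 ^ (-((1 / p).toReal * j)) * dyadicRearrangement μ f j)) ^ q.toReal ≤
        C * lzNorm p q c μ f ^ q.toReal := by
  obtain ⟨C, hC⟩ := exists_natWeight_mul_le_lzWeight p c
  have hq0 : 0 < q.toReal := ENNReal.toReal_pos (by positivity) hq'
  -- The factor 2 arises because the interval (2^{-(j+1)}, 2^{-j}) has length 2^{-(j+1)} while 1/t
  -- is only bounded below by 2^j.
  refine ⟨2 * C ^ q.toReal, fun μ _ f => ?_⟩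
  rw [lzNorm, if_neg hq', setOf_pos_ofReal_lt_univ, ← ENNReal.rpow_mul,
    one_div_mul_cancel hq0.ne', ENNReal.rpow_one]
  set H : ℝ → ℝ≥0∞ := fun t => (lzWeight p c t * rearrangement μ f (ENNReal.ofReal t)) ^ q.toReal
        * ENNReal.ofReal (1 / t) with hH
  set J : ℕ → Set ℝ := fun j => Set.Ioo (2⁻¹ ^ (j + 1)) (2⁻¹ ^ j) with hJ
  have hdisj : Pairwise (Function.onFun Disjoint J) := by
    have key : ∀ i j : ℕ, i < j → Disjoint (J i) (J j) := by
      intro i j hij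
      refine Set.disjoint_left.2 fun t hi hj => ?_
      have h1 : (2⁻¹ : ℝ) ^ j ≤ 2⁻¹ ^ (i + 1) :=
        pow_le_pow_of_le_one (by norm_num) (by norm_num) hij
      exact absurd (hi.1.trans hj.2) (not_lt.2 h1)
    intro i j hij
    rcases lt_or_gt_of_ne hij with h | h
    · exact key i j h
    · exact (key j i h).symm
  have hsub : (⋃ j, J j) ⊆ Set.Ioo 0 1 := by
    refine Set.iUnion_subset fun j t ht => ⟨?_, ?_⟩
    · exact lt_trans (by positivity) ht.1
    · exact lt_of_lt_of_le ht.2 (pow_le_one₀ (by norm_num) (by norm_num))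
  calc _ ≤ ∑' j, ((2 * C ^ q.toReal : ℝ≥0) : ℝ≥0∞) * ∫⁻ t in J j, H t := by
        refine ENNReal.tsum_le_tsum fun j => ?_
        set T := (natWeight c j * (2 ^ (-((1 / p).toReal * j)) * dyadicRearrangement μ f j)) ^
          q.toReal with hT
        have hvol : volume (J j) = 2⁻¹ ^ (j + 1) := by
          rw [hJ, Real.volume_Ioo]
          have : (2⁻¹ : ℝ) ^ j - 2⁻¹ ^ (j + 1) = 2⁻¹ ^ (j + 1) := by rw [pow_succ]; ring
          rw [this, ENNReal.ofReal_pow (by norm_num), ENNReal.ofReal_inv_of_pos (by norm_num)]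
          simp
        calc T = ∫⁻ t in J j, T * 2 ^ (j + 1) := by
              rw [setLIntegral_const, hvol, mul_assoc, ← mul_pow,
                ENNReal.mul_inv_cancel (by simp) (by simp), one_pow, mul_one]
          _ ≤ ∫⁻ t in J j, ((2 * C ^ q.toReal : ℝ≥0) : ℝ≥0∞) * H t := by
              refine setLIntegral_mono' measurableSet_Ioo fun t ht => ?_
              have ht0 : 0 < t := lt_trans (by positivity) ht.1
              have h1 : T ≤ (C * (lzWeight p c t * rearrangement μ f (ENNReal.ofReal t))) ^
                  q.toReal := by
                refine ENNReal.rpow_le_rpow ?_ hq0.le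
                rw [← mul_assoc, ← mul_assoc]
                exact mul_le_mul' (hC j t ht.1.le ht.2.le) (dyadicRearrangement_le μ f ht.2.le)
              have h2 : (2 : ℝ≥0∞) ^ j ≤ ENNReal.ofReal (1 / t) := by
                rw [← ENNReal.ofReal_ofNat, ← ENNReal.ofReal_pow (by norm_num)]
                apply ENNReal.ofReal_le_ofReal
                rw [one_div, le_inv_comm₀ (by positivity) ht0, ← inv_pow]
                exact ht.2.le
              calc T * 2 ^ (j + 1) ≤ (C * (lzWeight p c t *
                    rearrangement μ f (ENNReal.ofReal t))) ^ q.toReal *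
                      (ENNReal.ofReal (1 / t) * 2) := by
                    rw [pow_succ]
                    exact mul_le_mul' h1 (mul_le_mul' h2 le_rfl)
                _ = _ := by
                    rw [hH, ENNReal.mul_rpow_of_nonneg _ _ hq0.le, ENNReal.coe_mul,
                      ENNReal.coe_rpow_of_nonneg _ hq0.le]
                    push_cast
                    ring
          _ = _ := lintegral_const_mul' _ _ ENNReal.coe_ne_top
    _ = _ * ∫⁻ t in ⋃ j, J j, H t := by
        rw [ENNReal.tsum_mul_left, lintegral_iUnion (fun j => measurableSet_Ioo) hdisj]
    _ ≤ _ := mul_le_mul' le_rfl (lintegral_mono_set hsub)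

variable {I : Type*}

lemma two_pow_log_bounds (k : ℕ) :
    (2 : ℝ) ^ Nat.log 2 (k + 1) ≤ (k : ℝ) + 1 ∧ (k : ℝ) + 1 ≤ 2 ^ (Nat.log 2 (k + 1) + 1) := by
  have h1 := Nat.pow_log_le_self 2 (Nat.succ_ne_zero k)
  have h2 := Nat.lt_pow_succ_log_self (b := 2) (by norm_num) (k + 1)
  constructor
  · exact_mod_cast h1
  · exact_mod_cast h2.le

lemma seqRearrangement_le_dyadic (x : I → X) (k : ℕ) :
    seqRearrangement x k ≤ dyadicSeqRearrangement x (Nat.log 2 (k + 1)) := by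
  refine seqRearrangement_anti x ?_
  have h1 := Nat.pow_log_le_self 2 (Nat.succ_ne_zero k)
  simp only [Nat.succ_eq_add_one] at h1
  omega

lemma exists_lzSeqNorm_top_le_iSup_dyadic (p : ℝ≥0∞) (c : ℝ) :
    ∃ C : ℝ≥0, ∀ x : I → X,
      lzSeqNorm p ∞ c x ≤
        C * ⨆ i, natWeight c i * (2 ^ ((1 / p).toReal * i) * dyadicSeqRearrangement x i) := by
  obtain ⟨C, hC⟩ := exists_lzWeight_le_natWeight_mul p c
  refine ⟨C, fun x => ?_⟩
  rw [lzSeqNorm, if_pos rfl]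
  refine iSup_le fun k => ?_
  obtain ⟨h1, h2⟩ := two_pow_log_bounds k
  refine (mul_le_mul' (hC _ _ h1 h2) (seqRearrangement_le_dyadic x k)).trans ?_
  rw [mul_assoc, mul_assoc]
  exact mul_le_mul' le_rfl (le_iSup (fun i => natWeight c i *
    (2 ^ ((1 / p).toReal * i) * dyadicSeqRearrangement x i)) _)

/-- Exactly 2^i values of k have `Nat.log 2 (k + 1)` equal to i, which cancels the factor 2^{-i}. -/
lemma tsum_comp_log_mul_le (G : ℕ → ℝ≥0∞) :
    ∑' k : ℕ, G (Nat.log 2 (k + 1)) * 2⁻¹ ^ Nat.log 2 (k + 1) ≤ ∑' i, G i := by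
  have h1 : ∀ k : ℕ, G (Nat.log 2 (k + 1)) * 2⁻¹ ^ Nat.log 2 (k + 1) =
      ∑' i, if Nat.log 2 (k + 1) = i then G i * 2⁻¹ ^ i else 0 := by
    intro k
    rw [tsum_eq_single (Nat.log 2 (k + 1)) (fun i hi => if_neg hi.symm), if_pos rfl]
  simp_rw [h1]
  rw [ENNReal.tsum_comm]
  refine ENNReal.tsum_le_tsum fun i => ?_
  rw [tsum_eq_sum (s := Finset.Ico (2 ^ i - 1) (2 ^ (i + 1) - 1))]
  · calc _ ≤ ∑ k ∈ Finset.Ico (2 ^ i - 1) (2 ^ (i + 1) - 1), G i * 2⁻¹ ^ i :=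
          Finset.sum_le_sum fun k _ => by split_ifs <;> simp
      _ = G i := by
          have : 2 ^ (i + 1) - 1 - (2 ^ i - 1) = 2 ^ i := by
            have := Nat.one_le_two_pow (n := i)
            rw [pow_succ]; omega
          rw [Finset.sum_const, Nat.card_Ico, this, nsmul_eq_mul, mul_left_comm]
          push_cast
          rw [← mul_pow, ENNReal.mul_inv_cancel (by simp) (by simp), one_pow, mul_one]
  · intro k hk
    rw [if_neg]
    rintro rfl
    refine hk (Finset.mem_Ico.2 ?_)
    have h1 := Nat.pow_log_le_self 2 (Nat.succ_ne_zero k)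
    have h2 := Nat.lt_pow_succ_log_self (b := 2) (by norm_num) (k + 1)
    simp only [Nat.succ_eq_add_one] at h1 h2
    omega

lemma exists_lzSeqNorm_rpow_le_tsum_dyadic (p : ℝ≥0∞) {q : ℝ≥0∞} (hq : 1 ≤ q) (hq' : q ≠ ∞)
    (c : ℝ) :
    ∃ C : ℝ≥0, ∀ x : I → X,
      lzSeqNorm p q c x ^ q.toReal ≤
        C * ∑' i, (natWeight c i * (2 ^ ((1 / p).toReal * i) * dyadicSeqRearrangement x i)) ^
          q.toReal := by
  obtain ⟨C, hC⟩ := exists_lzWeight_le_natWeight_mul p c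
  have hq0 : 0 < q.toReal := ENNReal.toReal_pos (by positivity) hq'
  refine ⟨C ^ q.toReal, fun x => ?_⟩
  rw [lzSeqNorm, if_neg hq', ← ENNReal.rpow_mul, one_div_mul_cancel hq0.ne', ENNReal.rpow_one]
  set T : ℕ → ℝ≥0∞ := fun i => (natWeight c i * (2 ^ ((1 / p).toReal * i) *
    dyadicSeqRearrangement x i)) ^ q.toReal with hT
  calc _ ≤ ∑' k : ℕ, ((C ^ q.toReal : ℝ≥0) : ℝ≥0∞) *
          (T (Nat.log 2 (k + 1)) * 2⁻¹ ^ Nat.log 2 (k + 1)) := by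
        refine ENNReal.tsum_le_tsum fun k => ?_
        obtain ⟨h1, h2⟩ := two_pow_log_bounds k
        rw [← mul_assoc]
        refine mul_le_mul' ?_ ?_
        · rw [ENNReal.coe_rpow_of_nonneg _ hq0.le, hT, ← ENNReal.mul_rpow_of_nonneg _ _ hq0.le]
          refine ENNReal.rpow_le_rpow ?_ hq0.le
          rw [← mul_assoc, ← mul_assoc]
          refine mul_le_mul' ((hC _ _ h1 h2).trans_eq ?_) (seqRearrangement_le_dyadic x k)
          rw [mul_assoc]
        · have e : (2⁻¹ : ℝ≥0∞) ^ Nat.log 2 (k + 1) =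
              ENNReal.ofReal (1 / 2 ^ Nat.log 2 (k + 1)) := by
            rw [one_div, ← inv_pow, ENNReal.ofReal_pow (by norm_num),
              ENNReal.ofReal_inv_of_pos (by norm_num)]
            simp
          rw [e]
          apply ENNReal.ofReal_le_ofReal
          exact one_div_le_one_div_of_le (by positivity) h1
    _ = _ := ENNReal.tsum_mul_left
    _ ≤ _ := mul_le_mul' le_rfl (tsum_comp_log_mul_le T)

end DyadicNorms

/-! ### The dyadic inequality between coefficients and function -/

section DyadicHausdorffYoung

open UnitAddTorus

lemma two_rpow_ne_zero (x : ℝ) : (2 : ℝ≥0∞) ^ x ≠ 0 := by simp [ENNReal.rpow_eq_zero_iff]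

lemma two_rpow_ne_top (x : ℝ) : (2 : ℝ≥0∞) ^ x ≠ ∞ := by simp [ENNReal.rpow_eq_top_iff]

lemma two_rpow_add (x y : ℝ) : (2 : ℝ≥0∞) ^ (x + y) = 2 ^ x * 2 ^ y :=
  ENNReal.rpow_add x y (by simp) (by simp)

lemma two_inv_pow_eq_rpow (k : ℕ) : (2⁻¹ : ℝ≥0∞) ^ k = 2 ^ (-(k : ℝ)) := by
  rw [ENNReal.rpow_neg, ENNReal.rpow_natCast, ENNReal.inv_pow]

lemma two_rpow_pow (x : ℝ) (k : ℕ) : ((2 : ℝ≥0∞) ^ x) ^ k = 2 ^ (x * k) := by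
  rw [ENNReal.rpow_mul, ENNReal.rpow_natCast]

/-- The numbers `2^{-θ(i+1)} f^*(2^{-(i+1)})`. -/
noncomputable def scaledRearrangement {S X : Type*} [MeasurableSpace S] [NormedAddCommGroup X]
    (θ : ℝ) (μ : Measure S) (f : S → X) (i : ℕ) : ℝ≥0∞ :=
  2 ^ (-(θ * ((i + 1 : ℕ) : ℝ))) * dyadicRearrangement μ f (i + 1)

section

variable {S X : Type*} [MeasurableSpace S] [NormedAddCommGroup X]

lemma dyadicRearrangement_succ_eq (θ : ℝ) (μ : Measure S) (f : S → X) (i : ℕ) :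
    dyadicRearrangement μ f (i + 1) =
      2 ^ (θ * ((i + 1 : ℕ) : ℝ)) * scaledRearrangement θ μ f i := by
  rw [scaledRearrangement, ← mul_assoc, ← two_rpow_add, add_neg_cancel, ENNReal.rpow_zero, one_mul]

lemma two_rpow_mul_tsum_dyadicRearrangement {θ θ' : ℝ} (h : θ + θ' = 1) (μ : Measure S)
    (f : S → X) (j : ℕ) :
    2 ^ (θ' * j) * ∑' k, 2⁻¹ ^ (j + k) * dyadicRearrangement μ f (j + k + 1) =
      2 ^ θ * ∑' k, ((2 : ℝ≥0∞) ^ (-θ')) ^ k * scaledRearrangement θ μ f (j + k) := by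
  rw [← ENNReal.tsum_mul_left, ← ENNReal.tsum_mul_left]
  congr 1; ext k
  rw [dyadicRearrangement_succ_eq θ, two_inv_pow_eq_rpow, two_rpow_pow, ← mul_assoc, ← mul_assoc,
    ← mul_assoc, ← two_rpow_add, ← two_rpow_add, ← two_rpow_add]
  congr 2
  rw [← sub_eq_zero]
  push_cast
  linear_combination ((j : ℝ) + k) * h

lemma sum_dyadicRearrangement_rpow {p : ℝ} (hp : 0 < p) (μ : Measure S) (f : S → X) (j : ℕ) :
    ∑ i ∈ Finset.range j, 2⁻¹ ^ i * dyadicRearrangement μ f (i + 1) ^ p =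
      2 * ∑ i ∈ Finset.range j, scaledRearrangement p⁻¹ μ f i ^ p := by
  rw [Finset.mul_sum]
  refine Finset.sum_congr rfl fun i _ => ?_
  rw [dyadicRearrangement_succ_eq p⁻¹, ENNReal.mul_rpow_of_nonneg _ _ hp.le, ← ENNReal.rpow_mul,
    two_inv_pow_eq_rpow, ← mul_assoc, ← two_rpow_add]
  congr 1
  rw [show -(i : ℝ) + p⁻¹ * ((i + 1 : ℕ) : ℝ) * p = 1 by push_cast; field_simp; ring,
    ENNReal.rpow_one]

/-- As f*(1) = 0, the upper part at level 0 is f itself, and the L¹ bound for upper parts applies.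
-/
lemma integrable_of_tsum_scaledRearrangement_lt_top {μ : Measure S} [IsProbabilityMeasure μ] {θ θ' : ℝ} (h : θ + θ' = 1) {f : S → X}
    (hf : AEStronglyMeasurable f μ)
    (hfin : ∑' k, ((2 : ℝ≥0∞) ^ (-θ')) ^ k * scaledRearrangement θ μ f k < ∞) :
    Integrable f μ := by
  refine ⟨hf, ?_⟩
  have h1 := lintegral_enorm_upperPart_le hf 0
  have h2 := two_rpow_mul_tsum_dyadicRearrangement h μ f 0
  have h3 : upperPart μ f 0 = f := by
    refine Set.indicator_eq_self.2 fun s hs => ?_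
    change dyadicRearrangement μ f 0 < ‖f s‖ₑ
    rw [dyadicRearrangement, pow_zero, rearrangement_one, enorm_pos]
    exact hs
  rw [h3] at h1
  simp only [Nat.cast_zero, mul_zero, ENNReal.rpow_zero, one_mul, zero_add] at h1 h2
  rw [hasFiniteIntegral_iff_enorm]
  refine h1.trans_lt ?_
  rw [h2]
  exact ENNReal.mul_lt_top (two_rpow_ne_top _).lt_top hfin

end

variable {d : ℕ} {X : Type*} [NormedAddCommGroup X] [NormedSpace ℂ X]

/-- The dyadic form of the estimate obtained by splitting `f` at the level `f^*(2^{-j})`. -/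
lemma HasFourierType.exists_dyadic_le [CompleteSpace X] {p₀ : ℝ≥0∞} (hp : 1 < p₀)
    (hp' : p₀ ≠ ∞) (hX : HasFourierType d p₀ X) {p r : ℝ} (hpp : p = p₀.toReal)
    (hr : r = p₀.conjExponent.toReal) (hpr : p.HolderConjugate r) :
    ∃ C : ℝ≥0, ∀ f : UnitAddTorus (Fin d) → X, AEStronglyMeasurable f (torusMeasure d) →
      ∑' k, ((2 : ℝ≥0∞) ^ (-r⁻¹)) ^ k * scaledRearrangement p⁻¹ (torusMeasure d) f k < ∞ →
      ∀ j, (∑ i ∈ Finset.range (j + 1),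
          (2 ^ (r⁻¹ * i) * dyadicSeqRearrangement (mFourierCoeff f) i) ^ r) ^ r⁻¹ ≤
        C * (∑' k, ((2 : ℝ≥0∞) ^ (-r⁻¹)) ^ k * scaledRearrangement p⁻¹ (torusMeasure d) f (j + k) +
          (∑ i ∈ Finset.range (j + 1), scaledRearrangement p⁻¹ (torusMeasure d) f i ^ p) ^ p⁻¹) := by
  obtain ⟨C, hC⟩ := hX.exists_mFourierCoeff_le hp hp'
  have hp0 : 0 < p := hpr.pos
  have hr0 : 0 < r := hpr.symm.pos
  have hr1 : 1 ≤ r := hpr.symm.lt.le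
  have hK : (2 : ℝ≥0∞) ^ r⁻¹ * 2 ^ p⁻¹ + 2 ^ r⁻¹ * (C * 2 ^ p⁻¹) ≠ ∞ := by
    have := two_rpow_ne_top r⁻¹
    have := two_rpow_ne_top p⁻¹
    finiteness
  refine ⟨((2 : ℝ≥0∞) ^ r⁻¹ * 2 ^ p⁻¹ + 2 ^ r⁻¹ * (C * 2 ^ p⁻¹)).toNNReal, fun f hf hfin j => ?_⟩
  rw [ENNReal.coe_toNNReal hK]
  set μ := torusMeasure d
  set δ := scaledRearrangement p⁻¹ μ f with hδ
  have hδtop : ∀ i, δ i ≠ ∞ := by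
    intro i hi
    refine hfin.ne (ENNReal.tsum_eq_top_of_eq_top ⟨i, ?_⟩)
    rw [hi, ENNReal.mul_top (pow_ne_zero _ (two_rpow_ne_zero _))]
  have hint : Integrable f μ :=
    integrable_of_tsum_scaledRearrangement_lt_top hpr.inv_add_inv_eq_one hf hfin
  set g := upperPart μ f j with hg
  set h := lowerPart μ f j with hh
  have hnull := nullMeasurableSet_dyadicRearrangement_lt hf j
  have hgint : Integrable g μ := hint.indicator₀ hnull
  have hhint : Integrable h μ := hint.indicator₀ hnull.compl
  have hp00 : p₀ ≠ 0 := (zero_lt_one.trans hp).ne'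
  have hnorm : eLpNorm h p₀ μ ≤ 2 ^ p⁻¹ * (∑ i ∈ Finset.range (j + 1), δ i ^ p) ^ p⁻¹ := by
    rw [eLpNorm_eq_lintegral_rpow_enorm_toReal hp00 hp', ← hpp, one_div,
      ← ENNReal.mul_rpow_of_nonneg _ _ (by positivity)]
    refine ENNReal.rpow_le_rpow ?_ (by positivity)
    refine (lintegral_enorm_lowerPart_rpow_le hf j hp0).trans ?_
    rw [sum_dyadicRearrangement_rpow hp0]
    refine mul_le_mul' le_rfl (Finset.sum_le_sum_of_subset ?_)
    exact Finset.range_mono (Nat.le_succ j)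
  have hmem : MemLp h p₀ μ := by
    refine ⟨hhint.1, hnorm.trans_lt (ENNReal.mul_lt_top (two_rpow_ne_top _).lt_top ?_)⟩
    refine ENNReal.rpow_lt_top_of_nonneg (by positivity) (ENNReal.sum_ne_top.2 fun i _ => ?_)
    exact ENNReal.rpow_ne_top_of_nonneg hp0.le (hδtop i)
  set A := ∫⁻ s, ‖g s‖ₑ ∂μ with hA
  set z := mFourierCoeff h with hz
  have hA' : 2 ^ (r⁻¹ * j) * A ≤ 2 ^ p⁻¹ * ∑' k, ((2 : ℝ≥0∞) ^ (-r⁻¹)) ^ k * δ (j + k) := by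
    rw [hδ, ← two_rpow_mul_tsum_dyadicRearrangement hpr.inv_add_inv_eq_one]
    exact mul_le_mul' le_rfl (lintegral_enorm_upperPart_le hf j)
  have hz' : (∑' n, ‖z n‖ₑ ^ r) ^ r⁻¹ ≤
      C * (2 ^ p⁻¹ * (∑ i ∈ Finset.range (j + 1), δ i ^ p) ^ p⁻¹) := by
    have := hC h hmem
    rw [← hr, one_div] at this
    exact this.trans (mul_le_mul' le_rfl hnorm)
  -- The high part contributes the same constant A to every coefficient, hence also to every value
  -- of the rearrangement.
  have hxz : ∀ n, ‖mFourierCoeff f n‖ₑ ≤ A + ‖z n‖ₑ := by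
    intro n
    rw [← upperPart_add_lowerPart μ f j, mFourierCoeff_add hgint hhint]
    exact (enorm_add_le _ _).trans (add_le_add (enorm_mFourierCoeff_le _ _) le_rfl)
  have hpow : ∀ (i : ℕ) (y : ℝ≥0∞), (2 ^ (r⁻¹ * i) * y) ^ r = 2 ^ i * y ^ r := by
    intro i y
    rw [ENNReal.mul_rpow_of_nonneg _ _ hr0.le, ← ENNReal.rpow_mul, ← ENNReal.rpow_natCast]
    congr 2
    field_simp
  calc _ ≤ (∑ i ∈ Finset.range (j + 1),
          (2 ^ (r⁻¹ * i) * A + 2 ^ (r⁻¹ * i) * dyadicSeqRearrangement z i) ^ r) ^ r⁻¹ := by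
        refine ENNReal.rpow_le_rpow (Finset.sum_le_sum fun i _ => ?_) (by positivity)
        rw [← mul_add]
        exact ENNReal.rpow_le_rpow (mul_le_mul' le_rfl (seqRearrangement_le_add hxz _)) hr0.le
    _ ≤ (∑ i ∈ Finset.range (j + 1), (2 ^ (r⁻¹ * i) * A) ^ r) ^ r⁻¹ +
          (∑ i ∈ Finset.range (j + 1), (2 ^ (r⁻¹ * i) * dyadicSeqRearrangement z i) ^ r) ^ r⁻¹ := by
        rw [← one_div]
        exact ENNReal.Lp_add_le _ _ _ hr1
    -- For the constant, ∑_{i≤j} 2^i ≤ 2 · 2^j; for z, the dyadic sum is at most twice the r-th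
    -- power of its ℓ^r norm.
    _ ≤ 2 ^ r⁻¹ * (2 ^ (r⁻¹ * j) * A) + 2 ^ r⁻¹ * (∑' n, ‖z n‖ₑ ^ r) ^ r⁻¹ := by
        refine add_le_add ?_ ?_
        · simp_rw [hpow]
          rw [← ENNReal.rpow_le_rpow_iff hr0, ← ENNReal.rpow_mul, inv_mul_cancel₀ hr0.ne',
            ENNReal.rpow_one, ENNReal.mul_rpow_of_nonneg _ _ hr0.le, hpow, ← ENNReal.rpow_mul,
            inv_mul_cancel₀ hr0.ne', ENNReal.rpow_one, ← Finset.sum_mul, ← mul_assoc]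
          refine mul_le_mul' ?_ le_rfl
          rw [← pow_succ']
          have := Nat.geomSum_eq (le_refl 2) (j + 1)
          have h2 : ∑ i ∈ Finset.range (j + 1), 2 ^ i ≤ 2 ^ (j + 1) := by
            rw [this]; exact (Nat.div_le_self _ _).trans (Nat.sub_le _ _)
          exact_mod_cast h2
        · simp_rw [hpow]
          rw [← ENNReal.mul_rpow_of_nonneg _ _ (by positivity)]
          refine ENNReal.rpow_le_rpow ?_ (by positivity)
          exact (ENNReal.sum_le_tsum _).trans
            (tsum_two_pow_mul_dyadicSeqRearrangement_rpow_le z hr0)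
    _ ≤ 2 ^ r⁻¹ * (2 ^ p⁻¹ * ∑' k, ((2 : ℝ≥0∞) ^ (-r⁻¹)) ^ k * δ (j + k)) +
          2 ^ r⁻¹ * (C * (2 ^ p⁻¹ * (∑ i ∈ Finset.range (j + 1), δ i ^ p) ^ p⁻¹)) :=
        add_le_add (mul_le_mul' le_rfl hA') (mul_le_mul' le_rfl hz')
    _ ≤ _ := by
        set U := ∑' k, ((2 : ℝ≥0∞) ^ (-r⁻¹)) ^ k * δ (j + k)
        set V := (∑ i ∈ Finset.range (j + 1), δ i ^ p) ^ p⁻¹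
        have e : (2 : ℝ≥0∞) ^ r⁻¹ * (2 ^ p⁻¹ * U) + 2 ^ r⁻¹ * (C * (2 ^ p⁻¹ * V)) =
            2 ^ r⁻¹ * 2 ^ p⁻¹ * U + 2 ^ r⁻¹ * (C * 2 ^ p⁻¹) * V := by ring
        rw [e, mul_add]
        exact add_le_add (mul_le_mul' le_self_add le_rfl) (mul_le_mul' le_add_self le_rfl)

end DyadicHausdorffYoung

/-! ### Summation of the dyadic inequality in weighted sequence spaces -/

section Interpolation

/-- Polynomial growth of δ is beaten by ρ^k. This supplies the finiteness required for integrability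
of f and for the dyadic inequality. -/
lemma tsum_pow_mul_lt_top {ρ : ℝ≥0} (hρ : ρ < 1) {c : ℝ} {M : ℝ≥0∞} (hM : M ≠ ∞) {δ : ℕ → ℝ≥0∞}
    (h : ∀ i, natWeight c i * δ i ≤ M) : ∑' k, (ρ : ℝ≥0∞) ^ k * δ k < ∞ := by
  calc _ ≤ ∑' k, (ρ : ℝ≥0∞) ^ k * natWeight (-c) k * M := by
        refine ENNReal.tsum_le_tsum fun k => ?_
        rw [mul_assoc]
        refine mul_le_mul' le_rfl ?_
        calc δ k = natWeight (-c) k * (natWeight c k * δ k) := by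
              rw [← mul_assoc, ← natWeight_add, neg_add_cancel, natWeight_zero, one_mul]
          _ ≤ _ := mul_le_mul' le_rfl (h k)
    _ = _ := ENNReal.tsum_mul_right
    _ < ∞ := ENNReal.mul_lt_top (tsum_pow_mul_natWeight_lt_top hρ _) hM.lt_top

/-- Weighted summation of the dyadic estimate, `q < ∞`. -/
lemma exists_tsum_le_of_dyadic_le {p r q b : ℝ} (hp : 0 < p) (hr : 0 < r) (hq : 1 ≤ q)
    (hb : b < -q⁻¹) {ρ : ℝ≥0} (hρ : ρ < 1) :
    ∃ C : ℝ≥0, ∀ (K : ℝ≥0∞) (β δ : ℕ → ℝ≥0∞),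
      (∀ j, (∑ i ∈ Finset.range (j + 1), β i ^ r) ^ r⁻¹ ≤
        K * (∑' k, (ρ : ℝ≥0∞) ^ k * δ (j + k) +
          (∑ i ∈ Finset.range (j + 1), δ i ^ p) ^ p⁻¹)) →
      ∑' i, (natWeight (b + (max r q)⁻¹) i * β i) ^ q ≤
        C * K ^ q * ∑' i, (natWeight (b + (min p q)⁻¹) i * δ i) ^ q := by
  have hq0 : 0 < q := by linarith
  set m := -(b * q) with hm_def
  -- This is the assumption b < -1/q in the form needed by both Hardy inequalities.
  have hm : 1 < m := by
    have := mul_lt_mul_of_pos_right hb hq0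
    rw [neg_mul, inv_mul_cancel₀ hq0.ne'] at this
    linarith
  obtain ⟨C₁, hC₁⟩ := exists_tsum_natWeight_mul_rpow_le hm (div_pos hq0 hr)
  obtain ⟨C₂, hC₂⟩ := exists_tsum_natWeight_mul_rpow_sum_le hm (div_pos hq0 hp)
  obtain ⟨C₃, hC₃⟩ := exists_tsum_natWeight_mul_rpow_tsum_le hq hρ (a := -m)
  -- The exponents of the theorem coincide with those of the Hardy inequalities: the reverse one
  -- with power q/r here, the direct one with power q/p in `hmin`.
  have hmax : (b + (max r q)⁻¹) * q = -m + min (q / r) 1 := by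
    rw [add_mul, hm_def, neg_neg]
    congr 1
    rcases le_total r q with h | h
    · rw [max_eq_right h, min_eq_right ((one_le_div hr).2 h), inv_mul_cancel₀ hq0.ne']
    · rw [max_eq_left h, min_eq_left ((div_le_one hr).2 h), inv_mul_eq_div]
  have hmin : (b + (min p q)⁻¹) * q = -m + max (q / p) 1 := by
    rw [add_mul, hm_def, neg_neg]
    congr 1
    rcases le_total p q with h | h
    · rw [min_eq_left h, max_eq_left ((one_le_div hp).2 h), inv_mul_eq_div]
    · rw [min_eq_right h, max_eq_right ((div_le_one hp).2 h), inv_mul_cancel₀ hq0.ne']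
  refine ⟨C₁ * (2 ^ (q - 1) * (C₃ + C₂)), fun K β δ h => ?_⟩
  have hR : ∑' i, (natWeight (b + (min p q)⁻¹) i * δ i) ^ q =
      ∑' i, natWeight (-m + max (q / p) 1) i * δ i ^ q := by
    simp_rw [ENNReal.mul_rpow_of_nonneg _ _ hq0.le, natWeight_rpow, hmin]
  have hL : ∑' i, (natWeight (b + (max r q)⁻¹) i * β i) ^ q =
      ∑' i, natWeight (-m + min (q / r) 1) i * (β i ^ r) ^ (q / r) := by
    simp_rw [ENNReal.mul_rpow_of_nonneg _ _ hq0.le, natWeight_rpow, hmax, ← ENNReal.rpow_mul,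
      mul_div_cancel₀ q hr.ne']
  rw [hL, hR]
  set R := ∑' i, natWeight (-m + max (q / p) 1) i * δ i ^ q
  set U : ℕ → ℝ≥0∞ := fun j => ∑' k, (ρ : ℝ≥0∞) ^ k * δ (j + k) with hU
  set V : ℕ → ℝ≥0∞ := fun j => ∑ i ∈ Finset.range (j + 1), δ i ^ p with hV
  have h1 : ∀ j, (∑ i ∈ Finset.range (j + 1), β i ^ r) ^ (q / r) ≤
      K ^ q * (2 ^ (q - 1) * (U j ^ q + V j ^ (q / p))) := by
    intro j
    calc _ = ((∑ i ∈ Finset.range (j + 1), β i ^ r) ^ r⁻¹) ^ q := by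
          rw [← ENNReal.rpow_mul, inv_mul_eq_div]
      _ ≤ (K * (U j + V j ^ p⁻¹)) ^ q := ENNReal.rpow_le_rpow (h j) hq0.le
      _ = K ^ q * (U j + V j ^ p⁻¹) ^ q := ENNReal.mul_rpow_of_nonneg _ _ hq0.le
      _ ≤ _ := by
          refine mul_le_mul' le_rfl ((ENNReal.rpow_add_le_mul_rpow_add_rpow _ _ hq).trans_eq ?_)
          rw [← ENNReal.rpow_mul, inv_mul_eq_div]
  have h2 : ∑' j, natWeight (-m) j * U j ^ q ≤ C₃ * R := by
    refine (hC₃ δ).trans (mul_le_mul' le_rfl (ENNReal.tsum_le_tsum fun j => ?_))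
    refine mul_le_mul' (natWeight_mono ?_ j) le_rfl
    have : 1 ≤ max (q / p) 1 := le_max_right _ _
    linarith
  have h3 : ∑' j, natWeight (-m) j * V j ^ (q / p) ≤ C₂ * R := by
    refine (hC₂ fun i => δ i ^ p).trans_eq ?_
    simp_rw [← ENNReal.rpow_mul, mul_div_cancel₀ q hp.ne']
    rfl
  calc _ ≤ C₁ * ∑' j, natWeight (-m) j * (∑ i ∈ Finset.range (j + 1), β i ^ r) ^ (q / r) :=
        hC₁ fun i => β i ^ r
    _ ≤ C₁ * ∑' j, (K ^ q * 2 ^ (q - 1)) *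
          (natWeight (-m) j * U j ^ q + natWeight (-m) j * V j ^ (q / p)) := by
        refine mul_le_mul' le_rfl (ENNReal.tsum_le_tsum fun j => ?_)
        refine (mul_le_mul' le_rfl (h1 j)).trans_eq ?_
        ring
    _ = C₁ * ((K ^ q * 2 ^ (q - 1)) * (∑' j, natWeight (-m) j * U j ^ q +
          ∑' j, natWeight (-m) j * V j ^ (q / p))) := by
        rw [ENNReal.tsum_mul_left, ENNReal.tsum_add]
    _ ≤ C₁ * ((K ^ q * 2 ^ (q - 1)) * (C₃ * R + C₂ * R)) := by gcongr
    _ = _ := by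
        rw [ENNReal.coe_mul, ENNReal.coe_mul, ENNReal.coe_rpow_of_nonneg _ (by linarith)]
        push_cast
        ring

/-- Weighted supremum of the dyadic estimate. -/
lemma exists_natWeight_mul_le_of_dyadic_le {p r b : ℝ} (hp : 0 < p) (hr : 0 < r)
    (hb : b < 0) {ρ : ℝ≥0} (hρ : ρ < 1) :
    ∃ C : ℝ≥0, ∀ (K M : ℝ≥0∞) (β δ : ℕ → ℝ≥0∞),
      (∀ j, (∑ i ∈ Finset.range (j + 1), β i ^ r) ^ r⁻¹ ≤
        K * (∑' k, (ρ : ℝ≥0∞) ^ k * δ (j + k) +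
          (∑ i ∈ Finset.range (j + 1), δ i ^ p) ^ p⁻¹)) →
      (∀ i, natWeight (b + p⁻¹) i * δ i ≤ M) →
      ∀ j, natWeight b j * β j ≤ C * K * M := by
  -- The bound on δ gives δ_i^p ≤ (i+1)^{-bp-1} M^p, and since b < 0 these weights have partial sums
  -- of order (j+1)^{-bp}.
  obtain ⟨C₁, hC₁⟩ := exists_sum_natWeight_le (ε := -(b * p)) (by nlinarith)
  have hG := tsum_pow_mul_natWeight_lt_top hρ |(-b)|
  set G := ∑' k, (ρ : ℝ≥0∞) ^ k * natWeight |(-b)| k with hG_def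
  refine ⟨G.toNNReal + C₁ ^ p⁻¹, fun K M β δ h hM j => ?_⟩
  have hδ : ∀ i, δ i ≤ natWeight (-(b + p⁻¹)) i * M := by
    intro i
    calc δ i = natWeight (-(b + p⁻¹)) i * (natWeight (b + p⁻¹) i * δ i) := by
          rw [← mul_assoc, ← natWeight_add, neg_add_cancel, natWeight_zero, one_mul]
      _ ≤ _ := mul_le_mul' le_rfl (hM i)
  have hU : ∑' k, (ρ : ℝ≥0∞) ^ k * δ (j + k) ≤ G * (natWeight (-b) j * M) := by
    rw [hG_def, ← ENNReal.tsum_mul_right]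
    refine ENNReal.tsum_le_tsum fun k => ?_
    rw [mul_assoc]
    refine mul_le_mul' le_rfl ((hδ _).trans ?_)
    rw [← mul_assoc]
    refine mul_le_mul' ((natWeight_mono ?_ _).trans (natWeight_add_index_le (-b) j k)) le_rfl
    have : 0 < p⁻¹ := by positivity
    linarith
  have hV : (∑ i ∈ Finset.range (j + 1), δ i ^ p) ^ p⁻¹ ≤
      (C₁ : ℝ≥0∞) ^ p⁻¹ * (natWeight (-b) j * M) := by
    rw [ENNReal.rpow_inv_le_iff hp, ENNReal.mul_rpow_of_nonneg _ _ hp.le,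
      ENNReal.mul_rpow_of_nonneg _ _ hp.le, ← ENNReal.rpow_mul, inv_mul_cancel₀ hp.ne',
      ENNReal.rpow_one, natWeight_rpow, neg_mul, ← mul_assoc]
    calc _ ≤ ∑ i ∈ Finset.range (j + 1), natWeight (-(b * p) - 1) i * M ^ p := by
          refine Finset.sum_le_sum fun i _ => ?_
          refine (ENNReal.rpow_le_rpow (hδ i) hp.le).trans_eq ?_
          rw [ENNReal.mul_rpow_of_nonneg _ _ hp.le, natWeight_rpow]
          congr 2
          field_simp
          ring
      _ ≤ _ := by
          rw [← Finset.sum_mul]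
          exact mul_le_mul' (hC₁ j) le_rfl
  have hβ : β j ≤ (∑ i ∈ Finset.range (j + 1), β i ^ r) ^ r⁻¹ := by
    rw [ENNReal.le_rpow_inv_iff hr]
    exact Finset.single_le_sum (f := fun i => β i ^ r) (fun _ _ => zero_le) (by simp)
  calc natWeight b j * β j ≤ natWeight b j *
        (K * (G * (natWeight (-b) j * M) + (C₁ : ℝ≥0∞) ^ p⁻¹ * (natWeight (-b) j * M))) := by
        refine mul_le_mul' le_rfl ((hβ.trans (h j)).trans ?_)
        exact mul_le_mul' le_rfl (add_le_add hU hV)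
    _ = (natWeight b j * natWeight (-b) j) * ((G + (C₁ : ℝ≥0∞) ^ p⁻¹) * K * M) := by ring
    _ = _ := by
        rw [← natWeight_add, add_neg_cancel, natWeight_zero, one_mul, ENNReal.coe_add,
          ENNReal.coe_toNNReal hG.ne, ENNReal.coe_rpow_of_nonneg _ (by positivity)]

lemma natWeight_mul_scaledRearrangement_le {S X : Type*} [MeasurableSpace S]
    [NormedAddCommGroup X] (c θ : ℝ) (μ : Measure S) (f : S → X) (i : ℕ) :
    natWeight c i * scaledRearrangement θ μ f i ≤ natWeight |c| 1 *
      (natWeight c (i + 1) * (2 ^ (-(θ * ((i + 1 : ℕ) : ℝ))) * dyadicRearrangement μ f (i + 1))) := by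
  rw [← mul_assoc]
  exact mul_le_mul' (natWeight_le_add_index c i 1) le_rfl

end Interpolation

/-! ### Assembly of the theorem, separately for q = ∞ and q < ∞ -/

theorem mainTheorem3 {X : Type*} [NormedAddCommGroup X] [NormedSpace ℂ X] [CompleteSpace X]
    {d : ℕ} (hd : 1 ≤ d) {p₀ : ℝ≥0∞} (hp₁ : 1 < p₀) (hp₂ : p₀ ≤ 2)
    (hX : HasFourierType d p₀ X)
    {q : ℝ≥0∞} (hq : 1 ≤ q) {b : ℝ} (hb : b < -(1 / q).toReal) :
    ∃ C : ℝ≥0, ∀ f : UnitAddTorus (Fin d) → X,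
      MemLZ p₀ q (b + (1 / min p₀ q).toReal) (torusMeasure d) f →
        Integrable f (torusMeasure d) ∧
        MemLZSeq p₀.conjExponent q (b + (1 / max p₀.conjExponent q).toReal)
          (UnitAddTorus.mFourierCoeff f) ∧
        lzSeqNorm p₀.conjExponent q (b + (1 / max p₀.conjExponent q).toReal)
            (UnitAddTorus.mFourierCoeff f) ≤
          C * lzNorm p₀ q (b + (1 / min p₀ q).toReal) (torusMeasure d) f := by
  have hptop : p₀ ≠ ∞ := (hp₂.trans_lt (by simp)).ne
  have hrtop : p₀.conjExponent ≠ ∞ := by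
    simpa [ENNReal.conjExponent, tsub_eq_zero_iff_le] using hp₁
  have : p₀.HolderConjugate p₀.conjExponent := ENNReal.HolderConjugate.conjExponent hp₁.le
  have hp1 : 1 < p₀.toReal := by
    rw [← ENNReal.toReal_one]; exact (ENNReal.toReal_lt_toReal (by simp) hptop).2 hp₁
  have hpr : p₀.toReal.HolderConjugate p₀.conjExponent.toReal :=
    ENNReal.HolderConjugate.toReal hp1
  have hp0 := hpr.pos
  have hr0 := hpr.symm.pos
  obtain ⟨K, hK⟩ := hX.exists_dyadic_le hp₁ hptop rfl rfl hpr
  set p := p₀.toReal with hp_def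
  set r := p₀.conjExponent.toReal with hr_def
  have eθ : (1 / p₀).toReal = p⁻¹ := by rw [one_div, ENNReal.toReal_inv]
  have eθ' : (1 / p₀.conjExponent).toReal = r⁻¹ := by rw [one_div, ENNReal.toReal_inv]
  obtain ⟨ρ, hρ, hρ'⟩ : ∃ ρ : ℝ≥0, ρ < 1 ∧ (ρ : ℝ≥0∞) = 2 ^ (-r⁻¹) := by
    refine ⟨2 ^ (-r⁻¹), NNReal.rpow_lt_one_of_one_lt_of_neg (by norm_num) (by simpa using hr0), ?_⟩
    rw [ENNReal.coe_rpow_of_ne_zero (by norm_num)]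
    simp
  simp_rw [← hρ'] at hK
  set c := b + (1 / min p₀ q).toReal with hc
  set c' := b + (1 / max p₀.conjExponent q).toReal with hc'
  rcases eq_or_ne q ∞ with rfl | hqtop
  · have ec : c = b + p⁻¹ := by
      rw [hc, min_eq_left le_top, eθ]
    have ec' : c' = b := by
      rw [hc', max_eq_right le_top]; simp
    have hb0 : b < 0 := by simpa using hb
    obtain ⟨C₁, hC₁⟩ := exists_dyadic_le_lzNorm_top (S := UnitAddTorus (Fin d)) (X := X) p₀ c
    obtain ⟨C₂, hC₂⟩ := exists_natWeight_mul_le_of_dyadic_le hp0 hr0 hb0 hρ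
    obtain ⟨C₃, hC₃⟩ := exists_lzSeqNorm_top_le_iSup_dyadic (I := Fin d → ℤ) (X := X)
      p₀.conjExponent c'
    have hw := natWeight_ne_top |c| 1
    refine ⟨C₃ * (C₂ * K * ((natWeight |c| 1).toNNReal * C₁)), fun f hf => ?_⟩
    set L := lzNorm p₀ ∞ c (torusMeasure d) f with hL
    have hM : ∀ i, natWeight c i * scaledRearrangement p⁻¹ (torusMeasure d) f i ≤
        natWeight |c| 1 * (C₁ * L) := by
      intro i
      refine (natWeight_mul_scaledRearrangement_le c _ _ f i).trans (mul_le_mul' le_rfl ?_)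
      rw [← eθ]
      exact hC₁ (torusMeasure d) f (i + 1)
    have hMtop : natWeight |c| 1 * (C₁ * L) ≠ ∞ :=
      ENNReal.mul_ne_top hw (ENNReal.mul_ne_top (by simp) hf.2.ne)
    have hfin := tsum_pow_mul_lt_top hρ hMtop hM
    have hmain : lzSeqNorm p₀.conjExponent ∞ c' (UnitAddTorus.mFourierCoeff f) ≤
        ((C₃ * (C₂ * K * ((natWeight |c| 1).toNNReal * C₁)) : ℝ≥0) : ℝ≥0∞) * L := by
      refine (hC₃ _).trans ?_
      rw [ENNReal.coe_mul, mul_assoc]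
      refine mul_le_mul' le_rfl (iSup_le fun j => ?_)
      rw [ec', eθ']
      rw [ec] at hM
      refine (hC₂ K _ _ _ (hK f hf.1 hfin) hM j).trans_eq ?_
      rw [← ec]
      simp only [ENNReal.coe_mul, ENNReal.coe_toNNReal hw]
      ring
    refine ⟨integrable_of_tsum_scaledRearrangement_lt_top hpr.inv_add_inv_eq_one hf.1
      (by rwa [← hρ']), ?_, hmain⟩
    exact hmain.trans_lt (ENNReal.mul_lt_top ENNReal.coe_lt_top hf.2)
  · have hq1 : 1 ≤ q.toReal := by
      rw [← ENNReal.toReal_one]; exact ENNReal.toReal_mono hqtop hq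
    have hq0 : 0 < q.toReal := by linarith
    have ec : c = b + (min p q.toReal)⁻¹ := by
      rw [hc, one_div, ENNReal.toReal_inv, ENNReal.toReal_min hptop hqtop]
    have ec' : c' = b + (max r q.toReal)⁻¹ := by
      rw [hc', one_div, ENNReal.toReal_inv, ENNReal.toReal_max hrtop hqtop]
    have hb' : b < -q.toReal⁻¹ := by rwa [one_div, ENNReal.toReal_inv] at hb
    obtain ⟨C₁, hC₁⟩ := exists_tsum_dyadic_le_lzNorm (S := UnitAddTorus (Fin d)) (X := X) p₀ hq
      hqtop c
    obtain ⟨C₂, hC₂⟩ := exists_tsum_le_of_dyadic_le hp0 hr0 hq1 hb' hρ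
    obtain ⟨C₃, hC₃⟩ := exists_lzSeqNorm_rpow_le_tsum_dyadic (I := Fin d → ℤ) (X := X)
      p₀.conjExponent hq hqtop c'
    have hw := natWeight_ne_top |c| 1
    -- D is the constant for the q-th powers of the norms. The factor with `natWeight |c| 1` pays
    -- for the shift from i to i + 1 in `scaledRearrangement`.
    set D : ℝ≥0 := C₃ * (C₂ * K ^ q.toReal * ((natWeight |c| 1).toNNReal ^ q.toReal * C₁)) with hD
    refine ⟨D ^ q.toReal⁻¹, fun f hf => ?_⟩
    set L := lzNorm p₀ q c (torusMeasure d) f with hL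
    have hsum : ∑' i, (natWeight c i * scaledRearrangement p⁻¹ (torusMeasure d) f i) ^ q.toReal ≤
        natWeight |c| 1 ^ q.toReal * (C₁ * L ^ q.toReal) := by
      calc _ ≤ ∑' i : ℕ, natWeight |c| 1 ^ q.toReal * (natWeight c (i + 1) *
              (2 ^ (-(p⁻¹ * ((i + 1 : ℕ) : ℝ))) *
                dyadicRearrangement (torusMeasure d) f (i + 1))) ^ q.toReal := by
            refine ENNReal.tsum_le_tsum fun i => ?_
            rw [← ENNReal.mul_rpow_of_nonneg _ _ hq0.le]
            exact ENNReal.rpow_le_rpow (natWeight_mul_scaledRearrangement_le c _ _ f i) hq0.le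
        _ ≤ _ := by
            rw [ENNReal.tsum_mul_left]
            refine mul_le_mul' le_rfl (le_trans ?_ (hC₁ (torusMeasure d) f))
            rw [eθ]
            exact ENNReal.tsum_comp_le_tsum_of_injective (add_left_injective 1)
              (fun i : ℕ => (natWeight c i * (2 ^ (-(p⁻¹ * (i : ℝ))) *
                dyadicRearrangement (torusMeasure d) f i)) ^ q.toReal)
    have hLtop : L ^ q.toReal ≠ ∞ := ENNReal.rpow_ne_top_of_nonneg hq0.le hf.2.ne
    have hsumtop : natWeight |c| 1 ^ q.toReal * (C₁ * L ^ q.toReal) ≠ ∞ :=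
      ENNReal.mul_ne_top (ENNReal.rpow_ne_top_of_nonneg hq0.le hw)
        (ENNReal.mul_ne_top (by simp) hLtop)
    -- Each single term is bounded by the whole sum; this uniform bound suffices for convergence of
    -- the geometric series.
    have hM : ∀ i, natWeight c i * scaledRearrangement p⁻¹ (torusMeasure d) f i ≤
        (natWeight |c| 1 ^ q.toReal * (C₁ * L ^ q.toReal)) ^ q.toReal⁻¹ := by
      intro i
      rw [ENNReal.le_rpow_inv_iff hq0]
      exact (ENNReal.le_tsum i).trans hsum
    have hfin := tsum_pow_mul_lt_top hρ
      (ENNReal.rpow_ne_top_of_nonneg (by positivity) hsumtop) hM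
    have hmain : lzSeqNorm p₀.conjExponent q c' (UnitAddTorus.mFourierCoeff f) ≤
        ((D ^ q.toReal⁻¹ : ℝ≥0) : ℝ≥0∞) * L := by
      rw [← ENNReal.rpow_le_rpow_iff hq0, ENNReal.mul_rpow_of_nonneg _ _ hq0.le,
        ENNReal.coe_rpow_of_nonneg _ (by positivity), ← ENNReal.rpow_mul,
        inv_mul_cancel₀ hq0.ne', ENNReal.rpow_one]
      refine (hC₃ _).trans ?_
      rw [hD, ENNReal.coe_mul, mul_assoc]
      refine mul_le_mul' le_rfl ?_
      rw [ec', eθ']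
      refine (hC₂ K _ _ (hK f hf.1 hfin)).trans ?_
      rw [← ec]
      refine (mul_le_mul' le_rfl hsum).trans_eq ?_
      simp only [ENNReal.coe_mul, ENNReal.coe_rpow_of_nonneg _ hq0.le, ENNReal.coe_toNNReal hw]
      ring
    refine ⟨integrable_of_tsum_scaledRearrangement_lt_top hpr.inv_add_inv_eq_one hf.1
      (by rwa [← hρ']), ?_, hmain⟩
    exact hmain.trans_lt (ENNReal.mul_lt_top ENNReal.coe_lt_top hf.2)
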